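/- For an integer $n\ge 1$ let $\mathcal{A}_n$ be the $\mathbb{Q}$-algebra $\bigl(\prod_p \mathbb{Z}/p^n\mathbb{Z}\bigr)\big/\bigl(\bigoplus_p \mathbb{Z}/p^n\mathbb{Z}\bigr)$, where $p$ runs over all primes. For positive integers $k_1,\dots,k_r$ put $$\zeta_{\mathcal{A}_2}(k_1,\dots,k_r)=\Bigl(\sum_{1\le n_1<\cdots<n_r\le p-1}\frac{1}{n_1^{k_1}\cdots n_r^{k_r}}\bmod p^2\Bigr)_p,\qquad \zeta^{\star}_{\mathcal{A}_2}(k_1,\dots,k_r)=\Bigl(\sum_{1\le n_1\le\cdots\le n_r\le p-1}\frac{1}{n_1^{k_1}\cdots n_r^{k_r}}\bmod p^2\Bigr)_p$$ in $\mathcal{A}_2$. Let $\boldsymbol{p}=(p\bmod p^2)_p\in\mathcal{A}_2$ and, for an integer $k>1$, let $\beta_k=(B_{p-k}/k\bmod p^2)_p\in\mathcal{A}_2$, where $B_j$ is the $j$-th Bernoulli number (the finitely many primes $p\le k$ play no role). Let $\{2\}^a$ denote $2$ repeated $a$ times. Let $l,m$ be non-negative integers with $(l,m)\ne(0,0)$.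 Then $$\sum_{\substack{m_0+\cdots+m_{2l}=m\\ m_i\ge 0\,(0\le i\le 2l)}}\zeta_{\mathcal{A}_2}(\{2\}^{m_0},1,\{2\}^{m_1},3,\{2\}^{m_2},\dots,\{2\}^{m_{2l-2}},1,\{2\}^{m_{2l-1}},3,\{2\}^{m_{2l}})=(-1)^m\Bigl\{(-1)^l2^{1-2l}\binom{l+m}{l}-4\binom{2l+m}{2l}\Bigr\}\beta_{4l+2m+1}\boldsymbol{p}$$ and $$\sum_{\substack{m_0+\cdots+m_{2l}=m\\ m_i\ge 0\,(0\le i\le 2l)}}\zeta^{\star}_{\mathcal{A}_2}(\{2\}^{m_0},1,\{2\}^{m_1},3,\{2\}^{m_2},\dots,\{2\}^{m_{2l-2}},1,\{2\}^{m_{2l-1}},3,\{2\}^{m_{2l}})=(-1)^l2^{1-2l}\binom{l+m}{l}\beta_{4l+2m+1}\boldsymbol{p}.$$ -/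

import Mathlib

namespace FMZV

/-- The direct sum `⨁_p ℤ/pⁿℤ`, as the ideal of the product ring `∏_p ℤ/pⁿℤ` (over all primes `p`)
that consists of the families with only finitely many nonzero components. -/
def finiteSupportIdeal (n : ℕ) : Ideal (∀ p : Nat.Primes, ZMod ((p : ℕ) ^ n)) where
  carrier := {x | {p | x p ≠ 0}.Finite}
  zero_mem' := by simp
  add_mem' := by
    intro a b ha hb
    refine (Set.Finite.union ha hb).subset fun p hp => ?_
    by_contra h
    simp only [Set.mem_union, Set.mem_ofPred_eq, not_or, not_not] at h
    exact hp (by simp [h.1, h.2])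
  smul_mem' := by
    intro c x hx
    refine Set.Finite.subset hx fun p hp h => hp ?_
    simp [h]

/-- The ring `𝒜ₙ = (∏_p ℤ/pⁿℤ) / (⨁_p ℤ/pⁿℤ)`. -/
def A (n : ℕ) : Type :=
  (∀ p : Nat.Primes, ZMod ((p : ℕ) ^ n)) ⧸ finiteSupportIdeal n

noncomputable instance (n : ℕ) : CommRing (A n) :=
  inferInstanceAs (CommRing ((∀ p : Nat.Primes, ZMod ((p : ℕ) ^ n)) ⧸ finiteSupportIdeal n))

/-- The quotient map: the class `(x_p)_p ∈ 𝒜ₙ` of a family `x`. -/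
noncomputable def A.mk (n : ℕ) : (∀ p : Nat.Primes, ZMod ((p : ℕ) ^ n)) →+* A n :=
  Ideal.Quotient.mk (finiteSupportIdeal n)

/-- Two families have the same class exactly when they agree at all but finitely many primes. -/
theorem A.mk_eq_mk_iff (n : ℕ) (x y : ∀ p : Nat.Primes, ZMod ((p : ℕ) ^ n)) :
    A.mk n x = A.mk n y ↔ {p | x p ≠ y p}.Finite := by
  refine (Ideal.Quotient.mk_eq_mk_iff_sub_mem x y).trans ?_
  change {p | (x - y) p ≠ 0}.Finite ↔ _
  simp only [Pi.sub_apply, sub_ne_zero]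

/-- Every nonzero integer is invertible in `𝒜ₙ`. -/
theorem A.isUnit_intCast (n : ℕ) (a : ℤ) (ha : a ≠ 0) : IsUnit (a : A n) := by
  refine IsUnit.of_mul_eq_one
    (A.mk n fun p : Nat.Primes => ((a : ℤ) : ZMod ((p : ℕ) ^ n))⁻¹) ?_
  rw [← map_intCast (A.mk n) a, ← map_mul, ← map_one (A.mk n), A.mk_eq_mk_iff]
  have hfin : {p : Nat.Primes | (p : ℕ) ∣ a.natAbs}.Finite := by
    refine Set.Finite.of_finite_image (f := fun p : Nat.Primes => (p : ℕ)) ?_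
      Subtype.val_injective.injOn
    refine (Set.finite_Iic a.natAbs).subset ?_
    rintro _ ⟨p, hp, rfl⟩
    exact Nat.le_of_dvd (Int.natAbs_pos.mpr ha) hp
  refine hfin.subset fun p hp => ?_
  by_contra hdvd
  refine hp ?_
  have hcop : IsCoprime a (((p : ℕ) ^ n : ℕ) : ℤ) := by
    rw [Int.isCoprime_iff_gcd_eq_one, Int.gcd, Int.natAbs_natCast]
    exact Nat.Coprime.pow_right n ((Nat.Prime.coprime_iff_not_dvd p.2).mpr hdvd).symm
  have hu : IsUnit ((a : ℤ) : ZMod ((p : ℕ) ^ n)) :=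
    (ZMod.coe_int_isUnit_iff_isCoprime a _).mpr hcop.symm
  simpa using ZMod.mul_inv_of_unit _ hu

/-- The `ℚ`-algebra structure of `𝒜ₙ`: the unique ring homomorphism `ℚ → 𝒜ₙ`. -/
noncomputable instance (n : ℕ) : Algebra ℚ (A n) :=
  RingHom.toAlgebra (IsLocalization.lift (M := nonZeroDivisors ℤ) (S := ℚ)
    (g := Int.castRingHom (A n))
    fun a => A.isUnit_intCast n a (nonZeroDivisors.coe_ne_zero a))

/-- Reduction `q mod N` of a rational number whose denominator is coprime to `N`
(every rational number reduced below satisfies this for `N = pⁿ` and all but finitely many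
primes `p`, and elements of `𝒜ₙ` do not depend on finitely many components). -/
def ratMod (N : ℕ) (q : ℚ) : ZMod N := (q.num : ZMod N) * (q.den : ZMod N)⁻¹

open Classical in
/-- `∑_{1 ≤ n₁ < ⋯ < n_r ≤ N} 1 / (n₁^{k₁} ⋯ n_r^{k_r})` for the index `k = (k₁, …, k_r)`. -/
noncomputable def harmonicSum (N : ℕ) (k : List ℕ) : ℚ :=
  ∑ n ∈ (Fintype.piFinset fun _ : Fin k.length => Finset.Icc 1 N) with StrictMono n,
    1 / ∏ i, (n i : ℚ) ^ k.get i

open Classical in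
/-- `∑_{1 ≤ n₁ ≤ ⋯ ≤ n_r ≤ N} 1 / (n₁^{k₁} ⋯ n_r^{k_r})` for the index `k = (k₁, …, k_r)`. -/
noncomputable def harmonicSumStar (N : ℕ) (k : List ℕ) : ℚ :=
  ∑ n ∈ (Fintype.piFinset fun _ : Fin k.length => Finset.Icc 1 N) with Monotone n,
    1 / ∏ i, (n i : ℚ) ^ k.get i

/-- The finite multiple zeta value `ζ_{𝒜ₙ}(k)`. -/
noncomputable def zeta (n : ℕ) (k : List ℕ) : A n :=
  A.mk n fun p => ratMod ((p : ℕ) ^ n) (harmonicSum ((p : ℕ) - 1) k)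

/-- The finite multiple zeta-star value `ζ⋆_{𝒜ₙ}(k)`. -/
noncomputable def zetaStar (n : ℕ) (k : List ℕ) : A n :=
  A.mk n fun p => ratMod ((p : ℕ) ^ n) (harmonicSumStar ((p : ℕ) - 1) k)

/-- `β_k = (B_{p-k} / k mod p²)_p ∈ 𝒜₂`, for `k > 1`. The finitely many primes `p < k`, where
the subtraction is truncated, do not matter. -/
noncomputable def beta (k : ℕ) : A 2 :=
  A.mk 2 fun p => ratMod ((p : ℕ) ^ 2) (bernoulli ((p : ℕ) - k) / k)

/-- `𝒑 = (p mod p²)_p ∈ 𝒜₂`. -/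
noncomputable def bp : A 2 := A.mk 2 fun p => ((p : ℕ) : ZMod ((p : ℕ) ^ 2))

/-- The index `({2}^{m₀}, 1, {2}^{m₁}, 3, {2}^{m₂}, …, 1, {2}^{m_{2l-1}}, 3, {2}^{m_{2l}})`. -/
def insertTwos (l : ℕ) (m : Fin (2 * l + 1) → ℕ) : List ℕ :=
  List.replicate (m 0) 2 ++
    (List.ofFn fun i : Fin (2 * l) =>
      (if Even (i : ℕ) then 1 else 3) :: List.replicate (m i.succ) 2).flatten

end FMZV

/-! Work modulo p². Give an inserted 2 the weight -(1+T²)X (for star sums (1+T²)X) and each letter 1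
or 3 the weight 2TX. The series of the strict sums is then the entry P₀₀ of the ordered product P,
over 0 < k < p, of the matrices with diagonal 1 - (1+T²)X/k² and off-diagonal entries 2TX/k, 2TX/k³
(`insSeries_nestedSum_eq_transferProd`). The series of the star sums is P₀₀ / det P for the same P
(`insSeries_nestedSumStar_mul_det`).

Let A(Y) = ∏ (1 - Y/k²), with c_d the coefficient of Y^d. Three facts determine everything. (1) det
P = A((1+T)²X) A((1-T)²X), factor by factor. (2) Since k ↦ p - k reverses the list and negates its
entries modulo p, the off-diagonal entries of P are divisible by p, so det P = P₀₀ P₁₁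
(`det_primeTransfer`). (3) (1-T²) P₁₁ = A(X) - T² A(T²X) (`primeTransfer_one_one`). Here P₁₁ is the
(0,0) entry for the reversed list 1/(p-k) = -1/(k+s), where s = -p has square zero. The row
recursion of that product is also satisfied by products of solutions of two hypergeometric equations
(`partialSum_conv_succ`). Their coefficients are the increments of the partial products of A, and
the resulting convolution telescopes (`sub_mul_partialSum_conv`).

For d ≥ 1 and 2d+1 < p, Newton's identities and a Voronoi type congruence give c_d = -2p
B_{p-2d-1}/(2d+1), a multiple of p. Products of such series therefore add their coefficients in
these degrees: that of P₀₀ is c_d((1+T)^{2d} + (1-T)^{2d} - (1+T²+⋯+T^{2d})), and that of the star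
series is -c_d(1+T²+⋯+T^{2d}). Expanding both in the independent polynomials (1+T²)^m T^L, L+m = d,
and taking L = 2l gives the two formulas. -/

open Finset.HasAntidiagonal (antidiagonal)

namespace FMZV

/-! ### Reduction of rational numbers modulo N -/

/-- The rational `q` can be reduced modulo `N`. -/
def ModIntegral (N : ℕ) (q : ℚ) : Prop := IsUnit (q.den : ZMod N)

/-- Lowest terms are irrelevant: `q.den` divides any denominator `b`, so a unit `b` computes the
same residue. Sums and products can thus be reduced over the product of the denominators. -/
theorem ModIntegral.of_eq_div {N : ℕ} {q : ℚ} (a b : ℤ) (hb0 : b ≠ 0)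
    (hb : IsUnit (b : ZMod N)) (hq : q = a / b) :
    ModIntegral N q ∧ ratMod N q = a * (b : ZMod N)⁻¹ := by
  have hdvd : (q.den : ℤ) ∣ b := by
    rw [hq, ← Rat.divInt_eq_div]; exact Rat.den_dvd a b
  obtain ⟨c, hc⟩ := hdvd
  have hden : IsUnit (q.den : ZMod N) := by
    rw [hc, Int.cast_mul] at hb
    simpa using isUnit_of_mul_isUnit_left hb
  refine ⟨hden, ?_⟩
  have hcross : q.num * b = a * q.den := by
    have hbQ : (b : ℚ) ≠ 0 := by exact_mod_cast hb0
    have hdQ : (q.den : ℚ) ≠ 0 := by exact_mod_cast q.den_nz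
    have : (q.num : ℚ) / q.den = a / b := by rw [Rat.num_div_den, hq]
    rw [div_eq_div_iff hdQ hbQ] at this
    exact_mod_cast this
  have hcross' : (q.num : ZMod N) * b = a * q.den := by exact_mod_cast congrArg (Int.cast (R := ZMod N)) hcross
  have h1 : (q.den : ZMod N) * (q.den : ZMod N)⁻¹ = 1 := ZMod.mul_inv_of_unit _ hden
  have h2 : (b : ZMod N) * (b : ZMod N)⁻¹ = 1 := ZMod.mul_inv_of_unit _ hb
  calc ratMod N q = (q.num * b) * (b : ZMod N)⁻¹ * (q.den : ZMod N)⁻¹ := by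
        rw [ratMod]; linear_combination (-(q.num : ZMod N) * (q.den : ZMod N)⁻¹) * h2
    _ = _ := by rw [hcross']; linear_combination (a * (b : ZMod N)⁻¹) * h1

section
variable {N : ℕ}

theorem ModIntegral.add_and {q s : ℚ} (hq : ModIntegral N q) (hs : ModIntegral N s) :
    ModIntegral N (q + s) ∧ ratMod N (q + s) = ratMod N q + ratMod N s := by
  have hu : IsUnit (((q.den * s.den : ℕ) : ℤ) : ZMod N) := by
    push_cast; exact IsUnit.mul hq hs
  have hqd : (q.den : ℚ) ≠ 0 := by exact_mod_cast q.den_nz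
  have hsd : (s.den : ℚ) ≠ 0 := by exact_mod_cast s.den_nz
  have key := ModIntegral.of_eq_div (N := N) (q := q + s) (q.num * s.den + s.num * q.den)
    ((q.den * s.den : ℕ) : ℤ) (by exact_mod_cast mul_ne_zero q.den_nz s.den_nz) hu (by
      push_cast
      conv_lhs => rw [← Rat.num_div_den q, ← Rat.num_div_den s]
      field_simp)
  refine ⟨key.1, key.2.trans ?_⟩
  have h1 : (q.den : ZMod N) * (q.den : ZMod N)⁻¹ = 1 := ZMod.mul_inv_of_unit _ hq
  have h2 : (s.den : ZMod N) * (s.den : ZMod N)⁻¹ = 1 := ZMod.mul_inv_of_unit _ hs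
  have h3 := ZMod.mul_inv_of_unit _ hu
  push_cast at h3 ⊢
  rw [ratMod, ratMod]
  generalize ((q.den : ZMod N) * s.den)⁻¹ = t at *
  linear_combination (-t * s.num * q.den) * h2 + (-t * q.num * s.den) * h1 +
    (q.num * (q.den : ZMod N)⁻¹ + s.num * (s.den : ZMod N)⁻¹) * h3

theorem ModIntegral.mul_and {q s : ℚ} (hq : ModIntegral N q) (hs : ModIntegral N s) :
    ModIntegral N (q * s) ∧ ratMod N (q * s) = ratMod N q * ratMod N s := by
  have hu : IsUnit (((q.den * s.den : ℕ) : ℤ) : ZMod N) := by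
    push_cast; exact IsUnit.mul hq hs
  have hqd : (q.den : ℚ) ≠ 0 := by exact_mod_cast q.den_nz
  have hsd : (s.den : ℚ) ≠ 0 := by exact_mod_cast s.den_nz
  have key := ModIntegral.of_eq_div (N := N) (q := q * s) (q.num * s.num)
    ((q.den * s.den : ℕ) : ℤ) (by exact_mod_cast mul_ne_zero q.den_nz s.den_nz) hu (by
      push_cast
      conv_lhs => rw [← Rat.num_div_den q, ← Rat.num_div_den s]
      field_simp)
  refine ⟨key.1, key.2.trans ?_⟩
  have h1 : (q.den : ZMod N) * (q.den : ZMod N)⁻¹ = 1 := ZMod.mul_inv_of_unit _ hq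
  have h2 : (s.den : ZMod N) * (s.den : ZMod N)⁻¹ = 1 := ZMod.mul_inv_of_unit _ hs
  have h3 := ZMod.mul_inv_of_unit _ hu
  push_cast at h3 ⊢
  rw [ratMod, ratMod]
  generalize ((q.den : ZMod N) * s.den)⁻¹ = t at *
  linear_combination (-t * q.num * s.num * q.den * (q.den : ZMod N)⁻¹) * h2 +
    (-t * q.num * s.num) * h1 +
    (q.num * (q.den : ZMod N)⁻¹ * s.num * (s.den : ZMod N)⁻¹) * h3

theorem ModIntegral.intCast (a : ℤ) : ModIntegral N (a : ℚ) := by simp [ModIntegral]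

theorem ModIntegral.natCast (a : ℕ) : ModIntegral N (a : ℚ) := by simp [ModIntegral]

theorem ratMod_natCast (a : ℕ) : ratMod N (a : ℚ) = a := by simp [ratMod]

theorem ModIntegral.add {q s : ℚ} (hq : ModIntegral N q) (hs : ModIntegral N s) :
    ModIntegral N (q + s) := (hq.add_and hs).1

theorem ModIntegral.mul {q s : ℚ} (hq : ModIntegral N q) (hs : ModIntegral N s) :
    ModIntegral N (q * s) := (hq.mul_and hs).1

theorem ratMod_add {q s : ℚ} (hq : ModIntegral N q) (hs : ModIntegral N s) :
    ratMod N (q + s) = ratMod N q + ratMod N s := (hq.add_and hs).2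

theorem ratMod_mul {q s : ℚ} (hq : ModIntegral N q) (hs : ModIntegral N s) :
    ratMod N (q * s) = ratMod N q * ratMod N s := (hq.mul_and hs).2

theorem ModIntegral.pow {q : ℚ} (hq : ModIntegral N q) (k : ℕ) : ModIntegral N (q ^ k) := by
  induction k with
  | zero => simpa using ModIntegral.natCast (N := N) 1
  | succ k ih => rw [pow_succ]; exact ih.mul hq

theorem ratMod_pow {q : ℚ} (hq : ModIntegral N q) (k : ℕ) :
    ratMod N (q ^ k) = ratMod N q ^ k := by
  induction k with
  | zero => simpa using ratMod_natCast (N := N) 1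
  | succ k ih => rw [pow_succ, ratMod_mul (hq.pow k) hq, ih, pow_succ]

theorem ModIntegral.sum {ι : Type*} (t : Finset ι) (f : ι → ℚ)
    (h : ∀ i ∈ t, ModIntegral N (f i)) :
    ModIntegral N (∑ i ∈ t, f i) ∧ ratMod N (∑ i ∈ t, f i) = ∑ i ∈ t, ratMod N (f i) := by
  classical
  induction t using Finset.induction_on with
  | empty => simpa using And.intro (ModIntegral.natCast (N := N) 0) (ratMod_natCast (N := N) 0)
  | insert a t ha ih =>
    have ih' := ih fun i hi => h i (Finset.mem_insert_of_mem hi)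
    have h0 := h a (Finset.mem_insert_self _ _)
    rw [Finset.sum_insert ha, Finset.sum_insert ha, ratMod_add h0 ih'.1, ih'.2]
    exact ⟨h0.add ih'.1, rfl⟩

theorem ModIntegral.prod {ι : Type*} (t : Finset ι) (f : ι → ℚ)
    (h : ∀ i ∈ t, ModIntegral N (f i)) :
    ModIntegral N (∏ i ∈ t, f i) ∧ ratMod N (∏ i ∈ t, f i) = ∏ i ∈ t, ratMod N (f i) := by
  classical
  induction t using Finset.induction_on with
  | empty => simpa using And.intro (ModIntegral.natCast (N := N) 1) (ratMod_natCast (N := N) 1)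
  | insert a t ha ih =>
    have ih' := ih fun i hi => h i (Finset.mem_insert_of_mem hi)
    have h0 := h a (Finset.mem_insert_self _ _)
    rw [Finset.prod_insert ha, Finset.prod_insert ha, ratMod_mul h0 ih'.1, ih'.2]
    exact ⟨h0.mul ih'.1, rfl⟩

theorem ModIntegral.inv_natCast {a : ℕ} (h0 : a ≠ 0) (ha : IsUnit (a : ZMod N)) :
    ModIntegral N ((a : ℚ)⁻¹) ∧ ratMod N ((a : ℚ)⁻¹) = (a : ZMod N)⁻¹ := by
  simpa using ModIntegral.of_eq_div (N := N) (q := (a : ℚ)⁻¹) 1 (a : ℤ) (by exact_mod_cast h0)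
    (by simpa using ha) (by simp)

end

/-! ### Small units, and equality and scalars in `A n` -/

/-- A positive integer below the prime `p` is a unit modulo every power of `p`. -/
theorem isUnit_natCast_of_lt {p a : ℕ} (hp : p.Prime) (n : ℕ) (h0 : 0 < a) (hap : a < p) :
    IsUnit (a : ZMod (p ^ n)) := by
  rw [ZMod.isUnit_iff_coprime]
  exact Nat.Coprime.pow_right n
    ((Nat.Prime.coprime_iff_not_dvd hp).mpr (Nat.not_dvd_of_pos_of_lt h0 hap)).symm

theorem finite_primes_le (B : ℕ) : {p : Nat.Primes | (p : ℕ) ≤ B}.Finite :=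
  Set.Finite.of_finite_image (f := fun p : Nat.Primes => (p : ℕ))
    ((Set.finite_Iic B).subset (by rintro _ ⟨p, hp, rfl⟩; exact hp))
    Subtype.val_injective.injOn

theorem A.mk_eq_of_lt (n B : ℕ) (x y : ∀ p : Nat.Primes, ZMod ((p : ℕ) ^ n))
    (h : ∀ p : Nat.Primes, B < (p : ℕ) → x p = y p) : A.mk n x = A.mk n y := by
  rw [A.mk_eq_mk_iff]
  refine (finite_primes_le B).subset fun p hp => ?_
  by_contra hlt
  exact hp (h p (not_le.mp hlt))

theorem A.algebraMap_eq_mk (n : ℕ) (q : ℚ) :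
    algebraMap ℚ (A n) q = A.mk n fun p => ratMod ((p : ℕ) ^ n) q := by
  have hu : IsUnit ((q.den : ℤ) : A n) := A.isUnit_intCast n _ (by exact_mod_cast q.den_nz)
  refine hu.mul_left_cancel ?_
  have h1 : ((q.den : ℤ) : A n) * algebraMap ℚ (A n) q = (q.num : ℤ) := by
    rw [← map_intCast (algebraMap ℚ (A n)), ← map_intCast (algebraMap ℚ (A n)), ← map_mul]
    congr 1
    simp
  rw [h1, ← map_intCast (A.mk n), ← map_intCast (A.mk n), ← map_mul]
  refine A.mk_eq_of_lt n q.den _ _ fun p hp => ?_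
  have := ZMod.mul_inv_of_unit _ (isUnit_natCast_of_lt p.2 n q.den_pos hp)
  simp only [Pi.mul_apply, Pi.intCast_apply, ratMod, Int.cast_natCast]
  linear_combination (-(q.num : ZMod ((p : ℕ) ^ n))) * this

theorem A.smul_mk (n : ℕ) (q : ℚ) (x : ∀ p : Nat.Primes, ZMod ((p : ℕ) ^ n)) :
    q • A.mk n x = A.mk n fun p => ratMod ((p : ℕ) ^ n) q * x p := by
  rw [Algebra.smul_def, A.algebraMap_eq_mk, ← map_mul]
  rfl

/-! ### Recursive form of the harmonic sums -/

section NestedSums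
variable {R : Type*} [CommSemiring R]

/-- The nested sum `∑_{i₁ < ⋯ < i_r} x_{i₁}^{k₁} ⋯ x_{i_r}^{k_r}` over a list `x`. -/
def nestedSum : List R → List ℕ → R
  | _, [] => 1
  | [], _ :: _ => 0
  | x :: xs, c :: k => nestedSum xs (c :: k) + x ^ c * nestedSum xs k

/-- The nested sum `∑_{i₁ ≤ ⋯ ≤ i_r} x_{i₁}^{k₁} ⋯ x_{i_r}^{k_r}` over a list `x`. -/
def nestedSumStar : List R → List ℕ → R
  | _, [] => 1
  | [], _ :: _ => 0
  | x :: xs, c :: k => nestedSumStar xs (c :: k) + x ^ c * nestedSumStar (x :: xs) k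

@[simp] theorem nestedSum_nil_right (xs : List R) : nestedSum xs [] = 1 := by
  cases xs <;> rfl

@[simp] theorem nestedSum_nil_cons (c : ℕ) (k : List ℕ) :
    nestedSum ([] : List R) (c :: k) = 0 := rfl

theorem nestedSum_cons_cons (x : R) (xs : List R) (c : ℕ) (k : List ℕ) :
    nestedSum (x :: xs) (c :: k) = nestedSum xs (c :: k) + x ^ c * nestedSum xs k := rfl

@[simp] theorem nestedSumStar_nil_right (xs : List R) : nestedSumStar xs [] = 1 := by
  cases xs <;> simp [nestedSumStar]

@[simp] theorem nestedSumStar_nil_cons (c : ℕ) (k : List ℕ) :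
    nestedSumStar ([] : List R) (c :: k) = 0 := by simp [nestedSumStar]

theorem nestedSumStar_cons_cons (x : R) (xs : List R) (c : ℕ) (k : List ℕ) :
    nestedSumStar (x :: xs) (c :: k)
      = nestedSumStar xs (c :: k) + x ^ c * nestedSumStar (x :: xs) k := by
  rw [nestedSumStar]

end NestedSums

theorem ratMod_nestedSum (N : ℕ) (xs : List ℚ) (h : ∀ x ∈ xs, ModIntegral N x) (k : List ℕ) :
    ModIntegral N (nestedSum xs k) ∧
      ratMod N (nestedSum xs k) = nestedSum (xs.map (ratMod N)) k := by
  induction xs generalizing k with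
  | nil =>
    cases k with
    | nil => simpa [ratMod] using ModIntegral.natCast (N := N) 1
    | cons c k => simpa [ratMod] using ModIntegral.natCast (N := N) 0
  | cons x xs ih =>
    have hx := h x List.mem_cons_self
    have ih' := ih fun y hy => h y (List.mem_cons_of_mem _ hy)
    cases k with
    | nil => simpa [ratMod] using ModIntegral.natCast (N := N) 1
    | cons c k =>
      rw [List.map_cons, nestedSum_cons_cons, nestedSum_cons_cons,
        ratMod_add (ih' _).1 ((hx.pow c).mul (ih' _).1), ratMod_mul (hx.pow c) (ih' _).1,
        ratMod_pow hx, (ih' _).2, (ih' _).2]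
      exact ⟨(ih' _).1.add ((hx.pow c).mul (ih' _).1), rfl⟩

theorem ratMod_nestedSumStar (N : ℕ) (xs : List ℚ) (h : ∀ x ∈ xs, ModIntegral N x)
    (k : List ℕ) :
    ModIntegral N (nestedSumStar xs k) ∧
      ratMod N (nestedSumStar xs k) = nestedSumStar (xs.map (ratMod N)) k := by
  induction xs generalizing k with
  | nil =>
    cases k with
    | nil => simpa [ratMod] using ModIntegral.natCast (N := N) 1
    | cons c k => simpa [ratMod] using ModIntegral.natCast (N := N) 0
  | cons x xs ih =>
    have hx := h x List.mem_cons_self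
    have ih' := ih fun y hy => h y (List.mem_cons_of_mem _ hy)
    induction k with
    | nil => simpa [ratMod] using ModIntegral.natCast (N := N) 1
    | cons c k ihk =>
      rw [List.map_cons, nestedSumStar_cons_cons, nestedSumStar_cons_cons,
        ratMod_add (ih' _).1 ((hx.pow c).mul ihk.1), ratMod_mul (hx.pow c) ihk.1,
        ratMod_pow hx, (ih' _).2, ihk.2]
      exact ⟨(ih' _).1.add ((hx.pow c).mul ihk.1), rfl⟩

open Classical in
-- Split according to whether the smallest index equals the lower end `a`.
theorem sum_strictMono_cons (a N : ℕ) (haN : a ≤ N) (c : ℕ) (k : List ℕ) :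
    (∑ n ∈ (Fintype.piFinset fun _ : Fin (c :: k).length => Finset.Icc a N) with StrictMono n,
        1 / ∏ i, (n i : ℚ) ^ (c :: k).get i)
      = (∑ n ∈ (Fintype.piFinset fun _ : Fin (c :: k).length => Finset.Icc (a + 1) N)
          with StrictMono n, 1 / ∏ i, (n i : ℚ) ^ (c :: k).get i)
        + ((a : ℚ)⁻¹) ^ c * ∑ n ∈ (Fintype.piFinset fun _ : Fin k.length => Finset.Icc (a + 1) N)
          with StrictMono n, 1 / ∏ i, (n i : ℚ) ^ k.get i := by
  rw [← Finset.sum_filter_add_sum_filter_not _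
    (fun n : Fin (c :: k).length → ℕ => n ⟨0, by simp⟩ ≠ a)]
  congr 1
  · refine Finset.sum_congr ?_ fun _ _ => rfl
    ext n
    simp only [Finset.mem_filter, Fintype.mem_piFinset, Finset.mem_Icc]
    constructor
    · rintro ⟨⟨h1, h2⟩, h3⟩
      refine ⟨fun i => ⟨?_, (h1 i).2⟩, h2⟩
      have := h2.monotone (show (⟨0, by simp⟩ : Fin (c :: k).length) ≤ i from Nat.zero_le _)
      have := (h1 ⟨0, by simp⟩).1
      omega
    · rintro ⟨h1, h2⟩
      refine ⟨⟨fun i => ⟨by have := (h1 i).1; omega, (h1 i).2⟩, h2⟩, ?_⟩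
      have := (h1 ⟨0, by simp⟩).1
      omega
  · rw [Finset.mul_sum]
    refine Finset.sum_bij' (fun n _ => fun i : Fin k.length => n i.succ)
      (fun n _ => (Fin.cons a n : Fin (k.length + 1) → ℕ)) ?_ ?_ ?_ ?_ ?_
    · intro n hn
      simp only [Finset.mem_filter, Fintype.mem_piFinset, Finset.mem_Icc, not_not] at hn ⊢
      obtain ⟨⟨h1, h2⟩, h3⟩ := hn
      refine ⟨fun i => ⟨?_, (h1 _).2⟩, fun i j hij => h2 (Fin.succ_lt_succ_iff.mpr hij)⟩
      have : n ⟨0, by simp⟩ < n i.succ := h2 (Fin.succ_pos i)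
      omega
    · intro n hn
      simp only [Finset.mem_filter, Fintype.mem_piFinset, Finset.mem_Icc, not_not] at hn ⊢
      refine ⟨⟨fun i => ?_, ?_⟩, rfl⟩
      · refine Fin.cases ?_ (fun i => ?_) i
        · exact ⟨le_rfl, haN⟩
        · have := hn.1 i
          simp only [Fin.cons_succ]; omega
      · refine Fin.strictMono_iff_lt_succ.mpr fun i => ?_
        obtain ⟨i, hi⟩ := i
        cases i with
        | zero => exact (hn.1 ⟨0, hi⟩).1
        | succ i => exact hn.2 (show (⟨i, by omega⟩ : Fin k.length) < ⟨i + 1, hi⟩ from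
            Nat.lt_succ_self i)
    · intro n hn
      simp only [Finset.mem_filter, not_not] at hn
      funext i
      refine Fin.cases ?_ (fun i => ?_) i
      · exact hn.2.symm
      · rfl
    · intro n hn
      rfl
    · intro n hn
      simp only [Finset.mem_filter, not_not] at hn
      have : (∏ i, (n i : ℚ) ^ (c :: k).get i)
          = (a : ℚ) ^ c * ∏ i : Fin k.length, (n i.succ : ℚ) ^ k.get i := by
        refine (Fin.prod_univ_succ (n := k.length)
          (fun i => (n i : ℚ) ^ (c :: k).get i)).trans ?_
        congr 2
        exact_mod_cast hn.2
      rw [this]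
      simp [mul_comm]

open Classical in
theorem sum_strictMono_eq_nestedSum (len a N : ℕ) (h : a + len = N + 1) (k : List ℕ) :
    (∑ n ∈ (Fintype.piFinset fun _ : Fin k.length => Finset.Icc a N) with StrictMono n,
        1 / ∏ i, (n i : ℚ) ^ k.get i)
      = nestedSum ((List.range' a len).map fun n : ℕ => (n : ℚ)⁻¹) k := by
  induction len generalizing a k with
  | zero =>
    cases k with
    | nil =>
      rw [nestedSum_nil_right, Finset.filter_true_of_mem fun n _ i => i.elim0]
      simp
    | cons c k =>
      have : Finset.Icc a N = ∅ := Finset.Icc_eq_empty (by omega)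
      simp [this]
  | succ len ih =>
    cases k with
    | nil =>
      rw [nestedSum_nil_right, Finset.filter_true_of_mem fun n _ i => i.elim0]
      simp
    | cons c k =>
      rw [sum_strictMono_cons a N (by omega), ih (a + 1) (by omega), ih (a + 1) (by omega),
        List.range'_succ, List.map_cons, nestedSum_cons_cons]

theorem harmonicSum_eq_nestedSum (N : ℕ) (k : List ℕ) :
    harmonicSum N k = nestedSum ((List.range' 1 N).map fun n : ℕ => (n : ℚ)⁻¹) k :=
  sum_strictMono_eq_nestedSum N 1 N (by omega) k

open Classical in
-- As in the strict case, except that the value `a` may recur, so the remaining indices still start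
-- at `a`.
theorem sum_monotone_cons (a N : ℕ) (haN : a ≤ N) (c : ℕ) (k : List ℕ) :
    (∑ n ∈ (Fintype.piFinset fun _ : Fin (c :: k).length => Finset.Icc a N) with Monotone n,
        1 / ∏ i, (n i : ℚ) ^ (c :: k).get i)
      = (∑ n ∈ (Fintype.piFinset fun _ : Fin (c :: k).length => Finset.Icc (a + 1) N)
          with Monotone n, 1 / ∏ i, (n i : ℚ) ^ (c :: k).get i)
        + ((a : ℚ)⁻¹) ^ c * ∑ n ∈ (Fintype.piFinset fun _ : Fin k.length => Finset.Icc a N)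
          with Monotone n, 1 / ∏ i, (n i : ℚ) ^ k.get i := by
  rw [← Finset.sum_filter_add_sum_filter_not _
    (fun n : Fin (c :: k).length → ℕ => n ⟨0, by simp⟩ ≠ a)]
  congr 1
  · refine Finset.sum_congr ?_ fun _ _ => rfl
    ext n
    simp only [Finset.mem_filter, Fintype.mem_piFinset, Finset.mem_Icc]
    constructor
    · rintro ⟨⟨h1, h2⟩, h3⟩
      refine ⟨fun i => ⟨?_, (h1 i).2⟩, h2⟩
      have := h2 (show (⟨0, by simp⟩ : Fin (c :: k).length) ≤ i from Nat.zero_le _)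
      have := (h1 ⟨0, by simp⟩).1
      omega
    · rintro ⟨h1, h2⟩
      refine ⟨⟨fun i => ⟨by have := (h1 i).1; omega, (h1 i).2⟩, h2⟩, ?_⟩
      have := (h1 ⟨0, by simp⟩).1
      omega
  · rw [Finset.mul_sum]
    refine Finset.sum_bij' (fun n _ => fun i : Fin k.length => n i.succ)
      (fun n _ => (Fin.cons a n : Fin (k.length + 1) → ℕ)) ?_ ?_ ?_ ?_ ?_
    · intro n hn
      simp only [Finset.mem_filter, Fintype.mem_piFinset, Finset.mem_Icc, not_not] at hn ⊢
      exact ⟨fun i => hn.1.1 _, fun i j hij => hn.1.2 (Fin.succ_le_succ_iff.mpr hij)⟩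
    · intro n hn
      simp only [Finset.mem_filter, Fintype.mem_piFinset, Finset.mem_Icc, not_not] at hn ⊢
      refine ⟨⟨fun i => ?_, ?_⟩, rfl⟩
      · refine Fin.cases ?_ (fun i => ?_) i
        · exact ⟨le_rfl, haN⟩
        · exact hn.1 i
      · refine Fin.monotone_iff_le_succ.mpr fun i => ?_
        obtain ⟨i, hi⟩ := i
        cases i with
        | zero => exact (hn.1 ⟨0, hi⟩).1
        | succ i => exact hn.2 (show (⟨i, by omega⟩ : Fin k.length) ≤ ⟨i + 1, hi⟩ from
            Nat.le_succ i)
    · intro n hn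
      simp only [Finset.mem_filter, not_not] at hn
      funext i
      refine Fin.cases ?_ (fun i => ?_) i
      · exact hn.2.symm
      · rfl
    · intro n hn
      rfl
    · intro n hn
      simp only [Finset.mem_filter, not_not] at hn
      have : (∏ i, (n i : ℚ) ^ (c :: k).get i)
          = (a : ℚ) ^ c * ∏ i : Fin k.length, (n i.succ : ℚ) ^ k.get i := by
        refine (Fin.prod_univ_succ (n := k.length)
          (fun i => (n i : ℚ) ^ (c :: k).get i)).trans ?_
        congr 2
        exact_mod_cast hn.2
      rw [this]
      simp [mul_comm]

open Classical in
theorem sum_monotone_eq_nestedSumStar (len a N : ℕ) (h : a + len = N + 1) (k : List ℕ) :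
    (∑ n ∈ (Fintype.piFinset fun _ : Fin k.length => Finset.Icc a N) with Monotone n,
        1 / ∏ i, (n i : ℚ) ^ k.get i)
      = nestedSumStar ((List.range' a len).map fun n : ℕ => (n : ℚ)⁻¹) k := by
  induction len generalizing a k with
  | zero =>
    cases k with
    | nil =>
      rw [nestedSumStar_nil_right, Finset.filter_true_of_mem fun n _ i => i.elim0]
      simp
    | cons c k =>
      have : Finset.Icc a N = ∅ := Finset.Icc_eq_empty (by omega)
      simp [this]
  | succ len ih =>
    induction k with
    | nil =>
      rw [nestedSumStar_nil_right, Finset.filter_true_of_mem fun n _ i => i.elim0]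
      simp
    | cons c k ihk =>
      rw [sum_monotone_cons a N (by omega), ih (a + 1) (by omega), ihk,
        List.range'_succ, List.map_cons, nestedSumStar_cons_cons]

theorem harmonicSumStar_eq_nestedSumStar (N : ℕ) (k : List ℕ) :
    harmonicSumStar N k = nestedSumStar ((List.range' 1 N).map fun n : ℕ => (n : ℚ)⁻¹) k :=
  sum_monotone_eq_nestedSumStar N 1 N (by omega) k

theorem map_ratMod_range' {p : ℕ} (hp : p.Prime) (n : ℕ) :
    (∀ x ∈ (List.range' 1 (p - 1)).map (fun n : ℕ => (n : ℚ)⁻¹), ModIntegral (p ^ n) x) ∧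
    ((List.range' 1 (p - 1)).map fun n : ℕ => (n : ℚ)⁻¹).map (ratMod (p ^ n))
      = (List.range' 1 (p - 1)).map fun k : ℕ => (k : ZMod (p ^ n))⁻¹ := by
  have h : ∀ k ∈ List.range' 1 (p - 1), ModIntegral (p ^ n) ((k : ℚ)⁻¹) ∧
      ratMod (p ^ n) ((k : ℚ)⁻¹) = (k : ZMod (p ^ n))⁻¹ := by
    intro k hk
    rw [List.mem_range'_1] at hk
    exact ModIntegral.inv_natCast (by omega)
      (isUnit_natCast_of_lt hp n (by omega) (by omega))
  refine ⟨fun x hx => ?_, ?_⟩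
  · obtain ⟨k, hk, rfl⟩ := List.mem_map.mp hx
    exact (h k hk).1
  · rw [List.map_map]
    exact List.map_congr_left fun k hk => (h k hk).2

theorem ratMod_harmonicSum {p : ℕ} (hp : p.Prime) (n : ℕ) (k : List ℕ) :
    ratMod (p ^ n) (harmonicSum (p - 1) k)
      = nestedSum ((List.range' 1 (p - 1)).map fun k : ℕ => (k : ZMod (p ^ n))⁻¹) k := by
  rw [harmonicSum_eq_nestedSum, (ratMod_nestedSum _ _ (map_ratMod_range' hp n).1 k).2,
    (map_ratMod_range' hp n).2]

theorem ratMod_harmonicSumStar {p : ℕ} (hp : p.Prime) (n : ℕ) (k : List ℕ) :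
    ratMod (p ^ n) (harmonicSumStar (p - 1) k)
      = nestedSumStar ((List.range' 1 (p - 1)).map fun k : ℕ => (k : ZMod (p ^ n))⁻¹) k := by
  rw [harmonicSumStar_eq_nestedSumStar, (ratMod_nestedSumStar _ _ (map_ratMod_range' hp n).1 k).2,
    (map_ratMod_range' hp n).2]

/-! ### Inserted twos and their generating series -/

/-- The `b`-th letter of the alternating pattern `1, 3, 1, 3, …`. -/
def letter (b : ℕ) : ℕ := if Even b then 1 else 3

/-- The index obtained by inserting `μ i` twos after the `i`-th letter of the pattern
`letter b, letter (b + 1), …, letter (b + L - 1)`. -/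
def insertTwosFrom (b L : ℕ) (μ : Fin (L + 1) → ℕ) : List ℕ :=
  List.replicate (μ 0) 2 ++
    (List.ofFn fun i : Fin L => letter (i + b) :: List.replicate (μ i.succ) 2).flatten

theorem insertTwos_eq_insertTwosFrom (l : ℕ) (μ : Fin (2 * l + 1) → ℕ) :
    insertTwos l μ = insertTwosFrom 0 (2 * l) μ := rfl

theorem insertTwosFrom_cons_succ (b L i : ℕ) (ν : Fin L → ℕ) :
    insertTwosFrom b L (Fin.cons (i + 1) ν) = 2 :: insertTwosFrom b L (Fin.cons i ν) := rfl

theorem insertTwosFrom_cons_zero (b L : ℕ) (ν : Fin (L + 1) → ℕ) :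
    insertTwosFrom b (L + 1) (Fin.cons 0 ν) = letter b :: insertTwosFrom (b + 1) L ν := by
  simp only [insertTwosFrom, List.ofFn_succ, Fin.cons_zero, List.replicate_zero, List.nil_append,
    List.flatten_cons, List.cons_append, Fin.cons_succ, Fin.val_zero, zero_add, Fin.val_succ]
  congr 3
  refine List.ofFn_inj.mpr (funext fun i => ?_)
  rw [add_assoc, add_comm 1 b]

/-- The letters have period two, so only b = 0 and b = 1 matter; these are the two states of the
transfer matrix. -/
theorem insertTwosFrom_add_two (b L : ℕ) : insertTwosFrom (b + 2) L = insertTwosFrom b L := by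
  funext μ
  simp only [insertTwosFrom, letter, ← add_assoc, Nat.even_add, even_two, iff_true]

theorem sum_antidiagonalTuple_succ {M : Type*} [AddCommMonoid M] (k n : ℕ)
    (F : (Fin (k + 1) → ℕ) → M) :
    ∑ μ ∈ Finset.Nat.antidiagonalTuple (k + 1) n, F μ
      = ∑ q ∈ antidiagonal n, ∑ ν ∈ Finset.Nat.antidiagonalTuple k q.2,
          F (Fin.cons q.1 ν) := by
  rw [Finset.sum_sigma']
  refine Finset.sum_bij' (fun μ _ => ⟨(μ 0, ∑ i : Fin k, μ i.succ), fun i => μ i.succ⟩)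
    (fun s _ => Fin.cons s.1.1 s.2) ?_ ?_ ?_ ?_ ?_
  · intro μ hμ
    simp only [Finset.Nat.mem_antidiagonalTuple, Fin.sum_univ_succ] at hμ
    simp [hμ, Finset.Nat.mem_antidiagonalTuple]
  · rintro ⟨⟨i, j⟩, ν⟩ h
    simp only [Finset.mem_sigma, Finset.HasAntidiagonal.mem_antidiagonal, Finset.Nat.mem_antidiagonalTuple] at h
    simp [Finset.Nat.mem_antidiagonalTuple, Fin.sum_univ_succ, h]
  · intro μ _
    exact Fin.cons_self_tail μ
  · rintro ⟨⟨i, j⟩, ν⟩ h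
    simp only [Finset.mem_sigma, Finset.HasAntidiagonal.mem_antidiagonal, Finset.Nat.mem_antidiagonalTuple] at h
    simp [h.2]
  · intro μ _
    exact congrArg F (Fin.cons_self_tail μ).symm

section
variable {B : Type*} [CommRing B]

/-- The sum of `Φ` over all insertions of `m` twos into `letter b, …, letter (b + L - 1)`. -/
def insSum (Φ : List ℕ → B) (b L m : ℕ) : B :=
  ∑ μ ∈ Finset.Nat.antidiagonalTuple (L + 1) m, Φ (insertTwosFrom b L μ)

/-- The part of `insSum` of the indices that do not begin with an inserted two. -/
def insSumLetter (Φ : List ℕ → B) (b : ℕ) : ℕ → ℕ → B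
  | 0, 0 => Φ []
  | 0, _ + 1 => 0
  | L + 1, m => insSum (fun k => Φ (letter b :: k)) (b + 1) L m

/-- The part of `insSum` of the indices that begin with an inserted two. -/
def insSumTwo (Φ : List ℕ → B) (b L : ℕ) : ℕ → B
  | 0 => 0
  | m + 1 => insSum (fun k => Φ (2 :: k)) b L m

theorem sum_cons_zero_eq_insSumLetter (Φ : List ℕ → B) (b L m : ℕ) :
    ∑ ν ∈ Finset.Nat.antidiagonalTuple L m, Φ (insertTwosFrom b L (Fin.cons 0 ν))
      = insSumLetter Φ b L m := by
  cases L with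
  | zero =>
    cases m with
    | zero => simp [insSumLetter, insertTwosFrom]
    | succ m => simp [insSumLetter]
  | succ L => simp only [insSumLetter, insSum, insertTwosFrom_cons_zero]

theorem insSum_eq (Φ : List ℕ → B) (b L m : ℕ) :
    insSum Φ b L m = insSumTwo Φ b L m + insSumLetter Φ b L m := by
  rw [insSum, sum_antidiagonalTuple_succ]
  cases m with
  | zero => simp [insSumTwo, ← sum_cons_zero_eq_insSumLetter]
  | succ m =>
    rw [Finset.Nat.sum_antidiagonal_succ, sum_cons_zero_eq_insSumLetter, add_comm, insSumTwo,
      insSum, sum_antidiagonalTuple_succ]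
    simp only [insertTwosFrom_cons_succ]

open PowerSeries

/-- The generating series of `insSum`, where an inserted two has weight `x t` and a letter has
weight `y t`; only patterns that end on a `3` (or at a letter position of even number) count. -/
noncomputable def insSeries (x y : B) (Φ : List ℕ → B) (b : ℕ) : B⟦X⟧ :=
  PowerSeries.mk fun d => ∑ q ∈ antidiagonal d,
    if Even (q.1 + b) then x ^ q.2 * y ^ q.1 * insSum Φ b q.1 q.2 else 0

theorem insSeries_add_two (x y : B) (Φ : List ℕ → B) (b : ℕ) :
    insSeries x y Φ (b + 2) = insSeries x y Φ b := by
  simp only [insSeries, insSum, insertTwosFrom_add_two, ← add_assoc, Nat.even_add, even_two,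
    iff_true]

/-- A nonempty index begins with a two, which keeps the state `b`, or with the next letter, which
passes to `b + 1`. The empty index meets the parity condition only for even `b`. -/
theorem insSeries_eq (x y : B) (Φ : List ℕ → B) (b : ℕ) :
    insSeries x y Φ b = C (if Even b then Φ [] else 0)
      + C x * X * insSeries x y (fun k => Φ (2 :: k)) b
      + C y * X * insSeries x y (fun k => Φ (letter b :: k)) (b + 1) := by
  ext d
  cases d with
  | zero =>
    have h := insSum_eq Φ b 0 0
    simp only [insSumTwo, insSumLetter, zero_add] at h
    simp [insSeries, h]
  | succ d =>
    simp only [map_add, mul_assoc, coeff_C_mul, coeff_succ_X_mul, coeff_C, Nat.succ_ne_zero,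
      if_false, zero_add]
    simp only [insSeries, coeff_mk]
    have hsplit : ∀ q : ℕ × ℕ,
        (if Even (q.1 + b) then x ^ q.2 * y ^ q.1 * insSum Φ b q.1 q.2 else 0)
        = (if Even (q.1 + b) then x ^ q.2 * y ^ q.1 * insSumTwo Φ b q.1 q.2 else 0)
          + (if Even (q.1 + b) then x ^ q.2 * y ^ q.1 * insSumLetter Φ b q.1 q.2 else 0) := by
      intro q
      split_ifs
      · rw [insSum_eq, mul_add]
      · simp
    rw [Finset.sum_congr rfl fun q _ => hsplit q, Finset.sum_add_distrib,
      Finset.Nat.sum_antidiagonal_succ', Finset.Nat.sum_antidiagonal_succ]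
    simp only [insSumTwo, insSumLetter, mul_zero, ite_self, zero_add, Finset.mul_sum]
    congr 1
    · refine Finset.sum_congr rfl fun q _ => ?_
      split_ifs
      · ring
      · simp
    · refine Finset.sum_congr rfl fun q _ => ?_
      rw [add_assoc q.1 1 b, add_comm 1 b]
      split_ifs
      · ring
      · simp

theorem insSeries_add (x y : B) (Φ Ψ : List ℕ → B) (a : B) (b : ℕ) :
    insSeries x y (fun k => Φ k + a * Ψ k) b
      = insSeries x y Φ b + C a * insSeries x y Ψ b := by
  ext d
  simp only [map_add, coeff_C_mul, insSeries, coeff_mk, Finset.mul_sum, ← Finset.sum_add_distrib]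
  refine Finset.sum_congr rfl fun q _ => ?_
  split_ifs
  · simp only [insSum, Finset.sum_add_distrib, ← Finset.mul_sum]; ring
  · simp

theorem insSeries_nestedSum_cons (x y r : B) (rs : List B) (b : ℕ) :
    insSeries x y (nestedSum (r :: rs)) b
      = (1 + C x * X * C r ^ 2) * insSeries x y (nestedSum rs) b
        + C y * X * C r ^ letter b * insSeries x y (nestedSum rs) (b + 1) := by
  rw [insSeries_eq, insSeries_eq x y (nestedSum rs) b]
  simp only [nestedSum_cons_cons, insSeries_add, nestedSum_nil_right]
  rw [insSeries_eq x y (nestedSum rs) b]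
  simp only [nestedSum_nil_right, map_pow]
  ring

/-- The head `r` can be used again, so the relation is implicit in the series of `r :: rs`: a 2 × 2
linear system for b = 0, 1. -/
theorem insSeries_nestedSumStar_cons (x y r : B) (rs : List B) (b : ℕ) :
    insSeries x y (nestedSumStar (r :: rs)) b
      = insSeries x y (nestedSumStar rs) b
        + C x * X * C r ^ 2 * insSeries x y (nestedSumStar (r :: rs)) b
        + C y * X * C r ^ letter b * insSeries x y (nestedSumStar (r :: rs)) (b + 1) := by
  conv_lhs => rw [insSeries_eq]
  rw [insSeries_eq x y (nestedSumStar rs) b]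
  simp only [nestedSumStar_cons_cons, insSeries_add, nestedSumStar_nil_right, map_pow]
  ring

theorem insSeries_nestedSum_nil (x y : B) (b : ℕ) :
    insSeries x y (nestedSum ([] : List B)) b = if Even b then 1 else 0 := by
  have h0 : ∀ b, insSeries x y (fun _ : List ℕ => (0 : B)) b = 0 := by
    intro b; ext d; simp [insSeries, insSum]
  rw [insSeries_eq]
  simp only [nestedSum_nil_cons, h0]
  split_ifs <;> simp

theorem insSeries_nestedSumStar_nil (x y : B) (b : ℕ) :
    insSeries x y (nestedSumStar ([] : List B)) b = if Even b then 1 else 0 := by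
  have h0 : ∀ b, insSeries x y (fun _ : List ℕ => (0 : B)) b = 0 := by
    intro b; ext d; simp [insSeries, insSum]
  rw [insSeries_eq]
  simp only [nestedSumStar_nil_cons, h0]
  split_ifs <;> simp

end

/-! ### Transfer matrices and their symmetries -/

section Transfer
variable {R : Type*} [CommRing R]

/-- The transfer matrix: `ξ r²` is the weight of an inserted two, `η r` and `η r³` are the weights
of the letters `1` and `3`. -/
def transfer (ξ η r : R) : Matrix (Fin 2) (Fin 2) R :=
  !![1 + ξ * r ^ 2, η * r; η * r ^ 3, 1 + ξ * r ^ 2]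

/-- The ordered product of transfer matrices along a list. -/
def transferProd (ξ η : R) (rs : List R) : Matrix (Fin 2) (Fin 2) R :=
  (rs.map (transfer ξ η)).prod

theorem transferProd_nil (ξ η : R) : transferProd ξ η [] = 1 := rfl

theorem transferProd_cons (ξ η r : R) (rs : List R) :
    transferProd ξ η (r :: rs) = transfer ξ η r * transferProd ξ η rs := by
  simp [transferProd]

theorem transferProd_concat (ξ η r : R) (rs : List R) :
    transferProd ξ η (rs ++ [r]) = transferProd ξ η rs * transfer ξ η r := by
  simp [transferProd]

theorem transferProd_cons_apply (ξ η r : R) (rs : List R) (j : Fin 2) :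
    transferProd ξ η (r :: rs) 0 j
        = (1 + ξ * r ^ 2) * transferProd ξ η rs 0 j + η * r * transferProd ξ η rs 1 j ∧
    transferProd ξ η (r :: rs) 1 j
        = η * r ^ 3 * transferProd ξ η rs 0 j + (1 + ξ * r ^ 2) * transferProd ξ η rs 1 j := by
  simp [transferProd_cons, Matrix.mul_apply, transfer, Fin.sum_univ_two]

theorem transferProd_concat_apply (ξ η r : R) (rs : List R) (i : Fin 2) :
    transferProd ξ η (rs ++ [r]) i 0
        = transferProd ξ η rs i 0 * (1 + ξ * r ^ 2) + transferProd ξ η rs i 1 * (η * r ^ 3) ∧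
    transferProd ξ η (rs ++ [r]) i 1
        = transferProd ξ η rs i 0 * (η * r) + transferProd ξ η rs i 1 * (1 + ξ * r ^ 2) := by
  simp [transferProd_concat, Matrix.mul_apply, transfer, Fin.sum_univ_two]

theorem det_transferProd (ξ η : R) (rs : List R) :
    (transferProd ξ η rs).det
      = (rs.map fun r => 1 + (ξ - η) * r ^ 2).prod * (rs.map fun r => 1 + (ξ + η) * r ^ 2).prod := by
  induction rs with
  | nil => simp [transferProd_nil]
  | cons r rs ih =>
    have : (transfer ξ η r).det = (1 + (ξ - η) * r ^ 2) * (1 + (ξ + η) * r ^ 2) := by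
      simp [transfer, Matrix.det_fin_two_of]; ring
    rw [transferProd_cons, Matrix.det_mul, ih, this]
    simp only [List.map_cons, List.prod_cons]
    ring

/-- Reflection in the antidiagonal reverses products and fixes each transfer matrix, whose diagonal
entries are equal. -/
theorem transferProd_reverse (ξ η : R) (rs : List R) :
    transferProd ξ η rs.reverse = !![transferProd ξ η rs 1 1, transferProd ξ η rs 0 1;
      transferProd ξ η rs 1 0, transferProd ξ η rs 0 0] := by
  induction rs with
  | nil => simp [transferProd_nil, Matrix.one_fin_two]
  | cons r rs ih =>
    have h0 := transferProd_cons_apply ξ η r rs 0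
    have h1 := transferProd_cons_apply ξ η r rs 1
    rw [List.reverse_cons, transferProd_concat, ih, h0.1, h0.2, h1.1, h1.2, transfer,
      Matrix.mul_fin_two]
    congr! 3 <;> ring_nf

/-- Negating `r` conjugates the transfer matrix by diag(1, -1). -/
theorem transferProd_neg (ξ η : R) (rs : List R) :
    transferProd ξ η (rs.map fun r => -r) = !![transferProd ξ η rs 0 0, -transferProd ξ η rs 0 1;
      -transferProd ξ η rs 1 0, transferProd ξ η rs 1 1] := by
  induction rs with
  | nil => simp [transferProd_nil, Matrix.one_fin_two]
  | cons r rs ih =>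
    have h0 := transferProd_cons_apply ξ η r rs 0
    have h1 := transferProd_cons_apply ξ η r rs 1
    rw [List.map_cons, transferProd_cons, ih, h0.1, h0.2, h1.1, h1.2, transfer,
      Matrix.mul_fin_two]
    congr! 3 <;> ring_nf

theorem map_transferProd {S : Type*} [CommRing S] (φ : R →+* S) (ξ η : R) (rs : List R) (i j : Fin 2) :
    φ (transferProd ξ η rs i j) = transferProd (φ ξ) (φ η) (rs.map φ) i j := by
  induction rs generalizing i with
  | nil => simp [transferProd_nil, Matrix.one_apply, apply_ite φ]
  | cons r rs ih =>
    have h := transferProd_cons_apply ξ η r rs j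
    have h' := transferProd_cons_apply (φ ξ) (φ η) (φ r) (rs.map φ) j
    fin_cases i
    · simp only [List.map_cons, Fin.zero_eta, h.1, h'.1, map_add, map_mul, map_pow, map_one, ih]
    · simp only [List.map_cons, Fin.mk_one, h.2, h'.2, map_add, map_mul, map_pow, map_one, ih]

/-- If reversing the list negates its entries, the off-diagonal entries of the transfer product
equal their own negatives. -/
theorem two_mul_transferProd_offDiag (ξ η : R) (rs : List R)
    (h : rs.reverse = rs.map fun r => -r) :
    2 * transferProd ξ η rs 0 1 = 0 ∧ 2 * transferProd ξ η rs 1 0 = 0 := by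
  have h1 := transferProd_reverse ξ η rs
  rw [h, transferProd_neg] at h1
  have h01 := congrFun (congrFun h1 0) 1
  have h10 := congrFun (congrFun h1 1) 0
  simp at h01 h10
  constructor
  · linear_combination -h01
  · linear_combination -h10

/-- If reversing the list negates its entries modulo `ϖ`, and `ϖ² = 0`, then the product of the
off-diagonal entries of the transfer product vanishes. -/
theorem det_transferProd_of_reverse (ϖ : R) (hϖ : ϖ ^ 2 = 0) (h2 : IsUnit (2 : R)) (ξ η : R)
    (rs : List R) (h : rs.reverse.map (Ideal.Quotient.mk (Ideal.span {ϖ}))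
      = rs.map fun r => Ideal.Quotient.mk (Ideal.span {ϖ}) (-r)) :
    (transferProd ξ η rs).det = transferProd ξ η rs 0 0 * transferProd ξ η rs 1 1 := by
  set φ := Ideal.Quotient.mk (Ideal.span {ϖ})
  have key := two_mul_transferProd_offDiag (φ ξ) (φ η) (rs.map φ) (by
    rw [← List.map_reverse, h, List.map_map]
    exact List.map_congr_left fun r _ => map_neg φ r)
  have hmem : ∀ i j, 2 * transferProd (φ ξ) (φ η) (rs.map φ) i j = 0 →
      ∃ c, transferProd ξ η rs i j = ϖ * c := by
    intro i j hij
    rw [← map_transferProd, ← map_ofNat φ 2, ← map_mul, Ideal.Quotient.eq_zero_iff_mem,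
      Ideal.mem_span_singleton] at hij
    exact (h2.dvd_mul_left).mp hij
  obtain ⟨a, ha⟩ := hmem _ _ key.1
  obtain ⟨b, hb⟩ := hmem _ _ key.2
  rw [Matrix.det_fin_two, ha, hb]
  linear_combination (-a * b) * hϖ

end Transfer

/-! ### Generating series as entries of transfer products -/

section
variable {B : Type*} [CommRing B]
open PowerSeries

theorem insSeries_nestedSum_eq_transferProd (x y : B) (rs : List B) :
    insSeries x y (nestedSum rs) 0
        = transferProd (C x * X) (C y * X) (rs.map (C (R := B))) 0 0 ∧
    insSeries x y (nestedSum rs) 1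
        = transferProd (C x * X) (C y * X) (rs.map (C (R := B))) 1 0 := by
  induction rs with
  | nil => simp [insSeries_nestedSum_nil, transferProd_nil]
  | cons r rs ih =>
    have h := transferProd_cons_apply (C x * X) (C y * X) (C r) (rs.map (C (R := B))) 0
    rw [List.map_cons, h.1, h.2, insSeries_nestedSum_cons, insSeries_nestedSum_cons,
      insSeries_add_two x y _ 0, zero_add, ih.1, ih.2]
    constructor
    · simp [letter]
    · simp [letter]; ring

/-- Each step solves the implicit system with diagonal 1 - ξr² and off-diagonal entries -ηr, -ηr³.
Its adjugate is the transfer matrix with ξ negated; multiplying through by determinants avoids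
division. -/
theorem insSeries_nestedSumStar_mul_det (x y : B) (rs : List B) :
    insSeries x y (nestedSumStar rs) 0 * (transferProd (-(C x * X)) (C y * X) (rs.map (C (R := B)))).det
        = transferProd (-(C x * X)) (C y * X) (rs.map (C (R := B))) 0 0 ∧
    insSeries x y (nestedSumStar rs) 1 * (transferProd (-(C x * X)) (C y * X) (rs.map (C (R := B)))).det
        = transferProd (-(C x * X)) (C y * X) (rs.map (C (R := B))) 1 0 := by
  induction rs with
  | nil => simp [insSeries_nestedSumStar_nil, transferProd_nil]
  | cons r rs ih =>
    have h := transferProd_cons_apply (-(C x * X)) (C y * X) (C r) (rs.map (C (R := B))) 0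
    have g0 := insSeries_nestedSumStar_cons x y r rs 0
    have g1 := insSeries_nestedSumStar_cons x y r rs 1
    rw [insSeries_add_two x y _ 0] at g1
    simp only [letter, Even.zero, if_true, zero_add, Nat.not_even_one, if_false, pow_one] at g0 g1
    have hdet : (transfer (-(C x * X)) (C y * X) (C r)).det
        = (1 - C x * X * C r ^ 2) ^ 2 - (C y * X) ^ 2 * C r ^ 4 := by
      simp [transfer, Matrix.det_fin_two_of]; ring
    rw [List.map_cons, h.1, h.2, transferProd_cons, Matrix.det_mul, hdet, ← ih.1, ← ih.2]
    generalize (transferProd (-(C x * X)) (C y * X) (rs.map (C (R := B)))).det = D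
    constructor
    · linear_combination D * (1 - C x * X * C r ^ 2) * g0 + D * (C y * X * C r) * g1
    · linear_combination D * (1 - C x * X * C r ^ 2) * g1 + D * (C y * X * C r ^ 3) * g0

end

/-! ### Hypergeometric recursions and the evaluation of the diagonal entry -/

section Convolution
variable {R : Type*} [CommRing R]

/-- The convolution of two sequences. -/
def conv (f g : ℕ → R) (n : ℕ) : R := ∑ q ∈ antidiagonal n, f q.1 * g q.2

/-- The partial sums `f 0 + ⋯ + f n`. -/
def partialSum (f : ℕ → R) (n : ℕ) : R := ∑ i ∈ Finset.range (n + 1), f i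

theorem conv_comm (f g : ℕ → R) (n : ℕ) : conv f g n = conv g f n := by
  rw [conv, conv, ← Finset.Nat.sum_antidiagonal_swap]
  exact Finset.sum_congr rfl fun q _ => mul_comm _ _

/-- Both sides are coefficients of F·G/(1-x). -/
theorem conv_partialSum_left (f g : ℕ → R) (n : ℕ) :
    conv (partialSum f) g n = partialSum (conv f g) n := by
  induction n with
  | zero => simp [conv, partialSum]
  | succ n ih =>
    have h : partialSum (conv f g) (n + 1) = partialSum (conv f g) n + conv f g (n + 1) := by
      rw [partialSum, Finset.sum_range_succ]; rfl
    rw [h, ← ih, conv, conv, conv, Finset.Nat.sum_antidiagonal_succ, Finset.Nat.sum_antidiagonal_succ]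
    have : ∀ i, partialSum f (i + 1) = partialSum f i + f (i + 1) := fun i => by
      rw [partialSum, Finset.sum_range_succ]; rfl
    simp only [this, add_mul, Finset.sum_add_distrib]
    have h0 : partialSum f 0 = f 0 := by simp [partialSum]
    rw [h0]
    ring

/-- The Leibniz rule for θ = x d/dx, with the shift `s` put on the first factor. -/
theorem mul_conv (s : R) (f g : ℕ → R) (n : ℕ) :
    ((n : R) + s) * conv f g n
      = conv (fun i => ((i : R) + s) * f i) g n + conv f (fun j => (j : R) * g j) n := by
  simp only [conv, Finset.mul_sum, ← Finset.sum_add_distrib]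
  refine Finset.sum_congr rfl fun q hq => ?_
  rw [← Finset.HasAntidiagonal.mem_antidiagonal.mp hq]
  push_cast
  ring

/-- The recursion says (θ+s)²F = -Y·xF/(1-x) in the degrees concerned; multiply it by the series of
`h`. -/
theorem conv_sq_mul_left {N : ℕ} {s Y : R} {f : ℕ → R} (h0 : s ^ 2 * f 0 = 0)
    (hf : ∀ i < N, (((i + 1 : ℕ) : R) + s) ^ 2 * f (i + 1) = -Y * partialSum f i)
    (h : ℕ → R) {n : ℕ} (hn : n < N) :
    conv (fun i => ((i : R) + s) * (((i : R) + s) * f i)) h (n + 1)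
      = -Y * partialSum (conv f h) n := by
  rw [← conv_partialSum_left, conv, Finset.Nat.sum_antidiagonal_succ, conv, Finset.mul_sum]
  have : (((0 : ℕ) : R) + s) * ((((0 : ℕ) : R) + s) * f 0) = 0 := by
    rw [← h0]; push_cast; ring
  rw [this, zero_mul, zero_add]
  refine Finset.sum_congr rfl fun q hq => ?_
  have hq' := Finset.HasAntidiagonal.mem_antidiagonal.mp hq
  have := hf q.1 (by omega)
  linear_combination h q.2 * this

theorem partialSum_succ (f : ℕ → R) (n : ℕ) :
    partialSum f (n + 1) = partialSum f n + f (n + 1) := by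
  rw [partialSum, Finset.sum_range_succ]; rfl

/-- The companion of `conv f g`, for solutions `f`, `g` of hypergeometric recursions. -/
def convDeriv (s W Z : R) (f g : ℕ → R) (n : ℕ) : R :=
  W * conv f (fun j => (j : R) * g j) n + Z * conv (fun i => ((i : R) + s) * f i) g n

/-- The Leibniz rules for FG, (θ+s)F·G, F·θG and (θ+s)F·θG close up, because the two equations
replace second-order terms by partial sums. After dividing the second coordinate by q, where q² =
ZW, the step is right multiplication by the transfer matrix with ξ = -(Z+W), η = 2q. -/
theorem partialSum_conv_succ {N : ℕ} {s W Z : R} {f g : ℕ → R} (hs : s ^ 2 = 0)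
    (hf : ∀ i < N, (((i + 1 : ℕ) : R) + s) ^ 2 * f (i + 1) = -W * partialSum f i)
    (hg : ∀ i < N, ((i + 1 : ℕ) : R) ^ 2 * g (i + 1) = -Z * partialSum g i)
    {n : ℕ} (hn : n < N) {ρ : R} (hρ : (((n + 1 : ℕ) : R) + s) * ρ = -1) :
    partialSum (conv f g) (n + 1) = partialSum (conv f g) n * (1 - (Z + W) * ρ ^ 2)
        + 2 * ρ ^ 3 * partialSum (convDeriv s W Z f g) n ∧
    partialSum (convDeriv s W Z f g) (n + 1) = 2 * (Z * W) * ρ * partialSum (conv f g) n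
        + partialSum (convDeriv s W Z f g) n * (1 - (Z + W) * ρ ^ 2) := by
  have hf' := fun h => conv_sq_mul_left (by rw [hs, zero_mul]) hf h hn
  have hg' : ∀ h, conv h (fun j => (j : R) * ((j : R) * g j)) (n + 1)
      = -Z * partialSum (conv h g) n := fun h => by
    have := conv_sq_mul_left (s := 0) (N := N) (Y := Z) (f := g) (by simp)
      (fun i hi => by simpa using hg i hi) h hn
    rw [conv_comm]
    simp only [add_zero] at this
    rw [this]
    congr 2
    funext i
    rw [conv_comm]
  have hV : partialSum (convDeriv s W Z f g) n
      = W * partialSum (conv f fun j => (j : R) * g j) n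
        + Z * partialSum (conv (fun i => ((i : R) + s) * f i) g) n := by
    simp only [partialSum, convDeriv, Finset.sum_add_distrib, Finset.mul_sum]
  have e1 := mul_conv s f g (n + 1)
  have e2 := mul_conv s (fun i => ((i : R) + s) * f i) g (n + 1)
  have e3 := mul_conv s f (fun j => (j : R) * g j) (n + 1)
  have e4 := mul_conv s (fun i => ((i : R) + s) * f i) (fun j => (j : R) * g j) (n + 1)
  rw [hf'] at e2 e4
  rw [hg'] at e3 e4
  set E := conv (fun i => ((i : R) + s) * f i) (fun j => (j : R) * g j) (n + 1)
  set a := conv (fun i => ((i : R) + s) * f i) g (n + 1)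
  set b := conv f (fun j => (j : R) * g j) (n + 1)
  set ν : R := ((n + 1 : ℕ) : R) + s
  -- By `hρ`, -ρ inverts ν. The mixed term E is found first, since `a` and `b` depend on it.
  have hE : E = ρ * partialSum (convDeriv s W Z f g) n := by
    rw [hV]; linear_combination (-ρ) * e4 + E * hρ
  have ha : a = ρ * (W * partialSum (conv f g) n - E) := by
    linear_combination (-ρ) * e2 + a * hρ
  have hb : b = ρ * (Z * partialSum (conv f g) n - E) := by
    linear_combination (-ρ) * e3 + b * hρ
  have hU : conv f g (n + 1) = -ρ * (a + b) := by
    linear_combination (-ρ) * e1 + conv f g (n + 1) * hρ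
  rw [partialSum_succ, partialSum_succ]
  have hVn : convDeriv s W Z f g (n + 1) = W * b + Z * a := rfl
  rw [hVn, hU, ha, hb, hE]
  constructor <;> ring

/-- The product `∏_{k ≤ n} (1 - Y ρ_k²)`. -/
def oneSubProd (Y : R) (ρ : ℕ → R) (n : ℕ) : R := ∏ k ∈ Finset.range n, (1 - Y * ρ (k + 1) ^ 2)

/-- The increments of `oneSubProd`. -/
def oneSubIncr (Y : R) (ρ : ℕ → R) : ℕ → R
  | 0 => 1
  | n + 1 => -Y * ρ (n + 1) ^ 2 * oneSubProd Y ρ n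

theorem oneSubProd_succ (Y : R) (ρ : ℕ → R) (n : ℕ) :
    oneSubProd Y ρ (n + 1) = oneSubProd Y ρ n * (1 - Y * ρ (n + 1) ^ 2) :=
  Finset.prod_range_succ _ _

theorem partialSum_oneSubIncr (Y : R) (ρ : ℕ → R) (n : ℕ) :
    partialSum (oneSubIncr Y ρ) n = oneSubProd Y ρ n := by
  induction n with
  | zero => simp [partialSum, oneSubIncr, oneSubProd]
  | succ n ih => rw [partialSum_succ, ih, oneSubProd_succ, oneSubIncr]; ring

theorem sq_mul_oneSubIncr {s Y : R} {ρ : ℕ → R} {i : ℕ}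
    (hρ : (((i + 1 : ℕ) : R) + s) * ρ (i + 1) = -1) :
    (((i + 1 : ℕ) : R) + s) ^ 2 * oneSubIncr Y ρ (i + 1)
      = -Y * partialSum (oneSubIncr Y ρ) i := by
  rw [partialSum_oneSubIncr, oneSubIncr]
  linear_combination (-Y * oneSubProd Y ρ i) *
    ((((i + 1 : ℕ) : R) + s) * ρ (i + 1) - 1) * hρ

/-- For a single pair the second coordinate starts at Zs or Ws. The combination with coefficients W
and -Z cancels this, so it starts at (W-Z)·(1, 0), the first row of the empty product. -/
theorem sub_mul_transferProd {N : ℕ} {s Z W q : R} (hs : s ^ 2 = 0) (hq : q ^ 2 = Z * W)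
    {r ρ : ℕ → R} (hr : ∀ k < N, ((k + 1 : ℕ) : R) * r (k + 1) = 1)
    (hρ : ∀ k < N, (((k + 1 : ℕ) : R) + s) * ρ (k + 1) = -1) {n : ℕ} (hn : n ≤ N) :
    (W - Z) * transferProd (-(Z + W)) (2 * q) ((List.range' 1 n).map ρ) 0 0
        = W * partialSum (conv (oneSubIncr W ρ) (oneSubIncr Z r)) n
          - Z * partialSum (conv (oneSubIncr Z ρ) (oneSubIncr W r)) n ∧
    (W - Z) * (q * transferProd (-(Z + W)) (2 * q) ((List.range' 1 n).map ρ) 0 1)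
        = W * partialSum (convDeriv s W Z (oneSubIncr W ρ) (oneSubIncr Z r)) n
          - Z * partialSum (convDeriv s Z W (oneSubIncr Z ρ) (oneSubIncr W r)) n := by
  have hf : ∀ Y, ∀ i < N, (((i + 1 : ℕ) : R) + s) ^ 2 * oneSubIncr Y ρ (i + 1)
      = -Y * partialSum (oneSubIncr Y ρ) i := fun Y i hi => sq_mul_oneSubIncr (hρ i hi)
  have hg : ∀ Y, ∀ i < N, ((i + 1 : ℕ) : R) ^ 2 * oneSubIncr Y r (i + 1)
      = -Y * partialSum (oneSubIncr Y r) i := fun Y i hi => by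
    rw [partialSum_oneSubIncr, oneSubIncr]
    linear_combination (-Y * oneSubProd Y r i) * (((i + 1 : ℕ) : R) * r (i + 1) + 1) * hr i hi
  induction n with
  | zero =>
    simp [transferProd_nil, partialSum, conv, convDeriv, oneSubIncr]
    ring
  | succ n ih =>
    have ih' := ih (by omega)
    have h := transferProd_concat_apply (-(Z + W)) (2 * q) (ρ (n + 1)) ((List.range' 1 n).map ρ) 0
    have e1 := partialSum_conv_succ hs (hf W) (hg Z) (n := n) (by omega) (hρ n (by omega))
    have e2 := partialSum_conv_succ hs (hf Z) (hg W) (n := n) (by omega) (hρ n (by omega))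
    rw [List.range'_1_concat, List.map_append, List.map_singleton, add_comm 1 n, h.1, h.2, e1.1,
      e1.2, e2.1, e2.2]
    generalize ρ (n + 1) = ρ' at *
    constructor
    · linear_combination (1 - (Z + W) * ρ' ^ 2) * ih'.1 + 2 * ρ' ^ 3 * ih'.2
    · linear_combination (1 - (Z + W) * ρ' ^ 2) * ih'.2 + 2 * ρ' * (Z * W) * ih'.1
        + (W - Z) * transferProd (-(Z + W)) (2 * q) ((List.range' 1 n).map ρ) 0 0 * 2 * ρ' * hq

/-- Telescopes through (W-Z)r² + (1-Wr²) = 1-Zr². -/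
theorem sub_mul_sum_oneSubIncr (N : ℕ) (W Z : R) (r : ℕ → R) {J : ℕ} (hJ : J ≤ N) :
    (W - Z) * ∑ j ∈ Finset.range (J + 1),
        oneSubIncr Z r j * ∏ k ∈ Finset.Ico j N, (1 - W * r (k + 1) ^ 2)
      = W * oneSubProd W r N
        - Z * oneSubProd Z r J * ∏ k ∈ Finset.Ico J N, (1 - W * r (k + 1) ^ 2) := by
  induction J with
  | zero => simp [oneSubIncr, oneSubProd]; ring
  | succ J ih =>
    rw [Finset.sum_range_succ, mul_add, ih (by omega), Finset.prod_eq_prod_Ico_succ_bot (by omega),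
      oneSubIncr, oneSubProd_succ]
    ring

/-- For the reversed sequence, the partial sum up to N-j is the product over j < k ≤ N, so the
convolution is the telescoping sum with J = N. -/
theorem sub_mul_partialSum_conv (N : ℕ) (W Z : R) (r : ℕ → R) :
    (W - Z) * partialSum (conv (oneSubIncr W fun k => r (N + 1 - k)) (oneSubIncr Z r)) N
      = W * oneSubProd W r N - Z * oneSubProd Z r N := by
  have h := sub_mul_sum_oneSubIncr N W Z r le_rfl
  rw [Finset.Ico_self, Finset.prod_empty, mul_one] at h
  rw [← h, ← conv_partialSum_left, conv_comm, conv,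
    Finset.Nat.sum_antidiagonal_eq_sum_range_succ_mk]
  congr 1
  refine Finset.sum_congr rfl fun j hj => ?_
  have hj' := Finset.mem_range.mp hj
  congr 1
  rw [partialSum_oneSubIncr, oneSubProd, ← Finset.prod_range_reflect,
    Finset.prod_Ico_eq_prod_range]
  refine Finset.prod_congr rfl fun k hk => ?_
  have hk' := Finset.mem_range.mp hk
  congr 4
  omega

/-- The evaluation of the diagonal entry of the transfer product along the reversed list. -/
theorem sub_mul_transferProd_reflect {N : ℕ} {Z W q : R} (hp : ((N + 1 : ℕ) : R) ^ 2 = 0)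
    (hq : q ^ 2 = Z * W) {r : ℕ → R} (hr : ∀ k < N, ((k + 1 : ℕ) : R) * r (k + 1) = 1)
    (hreg : ∀ a : R, (W - Z) * a = 0 → a = 0) :
    (W - Z) * transferProd (-(Z + W)) (2 * q) ((List.range' 1 N).map r) 1 1
      = W * oneSubProd W r N - Z * oneSubProd Z r N := by
  have hrev : (List.range' 1 N).map (fun k => r (N + 1 - k)) = ((List.range' 1 N).map r).reverse := by
    rw [← List.map_reverse, List.reverse_range', List.map_map]
    refine List.ext_getElem (by simp) fun i h1 h2 => ?_
    simp at h1 ⊢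
    congr 1
    omega
  have h11 : transferProd (-(Z + W)) (2 * q) ((List.range' 1 N).map r) 1 1
      = transferProd (-(Z + W)) (2 * q) ((List.range' 1 N).map fun k => r (N + 1 - k)) 0 0 := by
    rw [hrev, transferProd_reverse]; simp
  have hρ : ∀ k < N, (((k + 1 : ℕ) : R) + -((N + 1 : ℕ) : R)) * r (N + 1 - (k + 1)) = -1 := by
    intro k hk
    have h := hr (N - k - 1) (by omega)
    have e : N - k - 1 + 1 = N - k := by omega
    rw [e, Nat.cast_sub hk.le] at h
    have e' : N + 1 - (k + 1) = N - k := by omega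
    rw [e']
    push_cast
    linear_combination -h
  -- The shift is s = -(N+1), with N+1 to become the prime.
  have key := (sub_mul_transferProd (by linear_combination hp) hq hr
    (ρ := fun k => r (N + 1 - k)) hρ le_rfl).1
  have e1 := sub_mul_partialSum_conv N W Z r
  have e2 := sub_mul_partialSum_conv N Z W r
  rw [h11]
  -- Evaluating each convolution costs a further factor W-Z, which is cancelled here.
  refine sub_eq_zero.mp (hreg _ ?_)
  linear_combination (W - Z) * key + W * e1 + Z * e2

end Convolution

/-! ### Bernoulli numbers and power sums modulo p² -/

/-- The recursion for B_i divides only by i+1, which is less than p. -/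
theorem modIntegral_bernoulli {p : ℕ} (hp : p.Prime) (n : ℕ) {i : ℕ} (hi : i + 1 < p) :
    ModIntegral (p ^ n) (bernoulli i) := by
  induction i using Nat.strong_induction_on with
  | _ i ih =>
    have h := sum_bernoulli (i + 1)
    rw [Finset.sum_range_succ] at h
    have hB : bernoulli i = (((i + 1 : ℕ) : ℚ))⁻¹ * ((if i + 1 = 1 then 1 else 0)
        + ((-1 : ℤ) : ℚ) * ∑ k ∈ Finset.range i, ((i + 1).choose k : ℚ) * bernoulli k) := by
      rw [← h, Nat.choose_succ_self_right]
      have : ((i + 1 : ℕ) : ℚ) ≠ 0 := by positivity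
      field_simp
      push_cast
      ring
    rw [hB]
    refine (ModIntegral.inv_natCast (by omega)
      (isUnit_natCast_of_lt hp n (by omega) hi)).1.mul (ModIntegral.add ?_ ?_)
    · split_ifs
      · simpa using ModIntegral.natCast (N := p ^ n) 1
      · simpa using ModIntegral.natCast (N := p ^ n) 0
    · refine (ModIntegral.intCast _).mul (ModIntegral.sum _ _ fun k hk => ?_).1
      have := Finset.mem_range.mp hk
      exact (ModIntegral.natCast _).mul (ih k this (by omega))

theorem natCast_self_sq (p : ℕ) : (p : ZMod (p ^ 2)) ^ 2 = 0 := by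
  exact_mod_cast ZMod.natCast_self (p ^ 2)

/-- Faulhaber's formula modulo `p²`. -/
theorem sum_range_pow_eq_bernoulli {p : ℕ} (hp : p.Prime) {k : ℕ} (hk : k + 1 < p) :
    ∑ j ∈ Finset.range p, (j : ZMod (p ^ 2)) ^ k = (p : ZMod (p ^ 2)) * ratMod (p ^ 2) (bernoulli k) := by
  have hint : ∀ i ∈ Finset.range (k + 1), ModIntegral (p ^ 2)
      (bernoulli i * ((k + 1).choose i : ℚ) * ((k + 1 : ℕ) : ℚ)⁻¹) := fun i hi =>
    ((modIntegral_bernoulli hp 2 (by have := Finset.mem_range.mp hi; omega)).mul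
      (ModIntegral.natCast _)).mul (ModIntegral.inv_natCast (by omega)
        (isUnit_natCast_of_lt hp 2 (by omega) hk)).1
  have h := sum_range_pow p k
  have hcast : ∑ j ∈ Finset.range p, (j : ZMod (p ^ 2)) ^ k
      = ratMod (p ^ 2) (∑ j ∈ Finset.range p, (j : ℚ) ^ k) := by
    have : ∑ j ∈ Finset.range p, (j : ℚ) ^ k = ((∑ j ∈ Finset.range p, j ^ k : ℕ) : ℚ) := by
      push_cast; rfl
    rw [this, ratMod_natCast]
    push_cast; rfl
  have hsum : ∑ i ∈ Finset.range (k + 1),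
      bernoulli i * ((k + 1).choose i) * (p : ℚ) ^ (k + 1 - i) / (k + 1)
      = ∑ i ∈ Finset.range (k + 1),
        bernoulli i * ((k + 1).choose i : ℚ) * ((k + 1 : ℕ) : ℚ)⁻¹ * ((p : ℚ)) ^ (k + 1 - i) := by
    refine Finset.sum_congr rfl fun i _ => ?_
    push_cast
    ring
  rw [hcast, h, hsum, (ModIntegral.sum _ _ fun i hi => (hint i hi).mul
    ((ModIntegral.natCast p).pow _)).2, Finset.sum_range_succ, Finset.sum_eq_zero, zero_add]
  · rw [Nat.choose_succ_self_right, mul_assoc (bernoulli k),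
      mul_inv_cancel₀ (by positivity : ((k + 1 : ℕ) : ℚ) ≠ 0), mul_one,
      ratMod_mul (modIntegral_bernoulli hp 2 hk) ((ModIntegral.natCast p).pow _),
      ratMod_pow (ModIntegral.natCast p), ratMod_natCast]
    simp [mul_comm]
  · intro i hi
    have hi' := Finset.mem_range.mp hi
    rw [ratMod_mul (hint i (Finset.mem_range.mpr (by omega))) ((ModIntegral.natCast p).pow _),
      ratMod_pow (ModIntegral.natCast p), ratMod_natCast]
    -- Every term of Faulhaber's formula with i < k contains p².
    obtain ⟨c, hc⟩ : ∃ c, k + 1 - i = 2 + c := ⟨k - 1 - i, by omega⟩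
    rw [hc, pow_add, natCast_self_sq]
    ring

theorem sum_mul_mod {M : Type*} [AddCommMonoid M] {p : ℕ} (hp : p.Prime) {m : ℕ}
    (hm : ¬ p ∣ m) (F : ℕ → M) :
    ∑ j ∈ Finset.Ico 1 p, F (j * m % p) = ∑ j ∈ Finset.Ico 1 p, F j := by
  have hmaps : ∀ j ∈ Finset.Ico 1 p, j * m % p ∈ Finset.Ico 1 p := by
    intro j hj
    rw [Finset.mem_Ico] at hj ⊢
    refine ⟨Nat.one_le_iff_ne_zero.mpr fun h => ?_, Nat.mod_lt _ hp.pos⟩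
    rcases (hp.dvd_mul).mp (Nat.dvd_of_mod_eq_zero h) with h | h
    · exact Nat.not_dvd_of_pos_of_lt hj.1 hj.2 h
    · exact hm h
  have hinj : Set.InjOn (fun j => j * m % p) (Finset.Ico 1 p : Finset ℕ) := by
    intro i hi j hj hij
    rw [Finset.mem_coe, Finset.mem_Ico] at hi hj
    have h : i ≡ j [MOD p] := Nat.ModEq.cancel_right_of_coprime
      ((Nat.Prime.coprime_iff_not_dvd hp).mpr hm) hij
    rwa [Nat.ModEq, Nat.mod_eq_of_lt hi.2, Nat.mod_eq_of_lt hj.2] at h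
  exact Finset.sum_nbij (fun j => j * m % p) hmaps hinj
    (Finset.surjOn_of_injOn_of_card_le _ hmaps hinj le_rfl) fun _ _ => rfl

theorem sub_mul_pow {R : Type*} [CommRing R] {ϖ : R} (h : ϖ ^ 2 = 0) (a f : R) (k : ℕ) :
    (a - ϖ * f) ^ (k + 1) = a ^ (k + 1) - (k + 1) * ϖ * f * a ^ k := by
  induction k with
  | zero => simp
  | succ k ih =>
    rw [pow_succ, ih]
    push_cast
    linear_combination ((k + 1) * f ^ 2 * a ^ k) * h

theorem mul_natCast_eq_of_modEq {p a b : ℕ} (h : a ≡ b [MOD p]) :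
    (p : ZMod (p ^ 2)) * a = p * b := by
  have : ((p * a : ℕ) : ZMod (p ^ 2)) = ((p * b : ℕ) : ZMod (p ^ 2)) := by
    rw [ZMod.natCast_eq_natCast_iff, sq]
    exact h.mul_left' p
  exact_mod_cast this

/-- A primitive root has order p-1 > e. -/
theorem exists_pow_not_modEq_one {p : ℕ} (hp : p.Prime) {e : ℕ} (h0 : 0 < e) (he : e < p - 1) :
    ∃ m : ℕ, ¬ p ∣ m ∧ ¬ m ^ e ≡ 1 [MOD p] := by
  have := Fact.mk hp
  obtain ⟨g, hg⟩ := IsCyclic.exists_ofOrder_eq_natCard (α := (ZMod p)ˣ)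
  rw [Nat.card_eq_fintype_card, ZMod.card_units] at hg
  refine ⟨(g : ZMod p).val, ?_, ?_⟩
  · rw [← ZMod.natCast_eq_zero_iff, ZMod.natCast_zmod_val]
    exact g.ne_zero
  · rw [← ZMod.natCast_eq_natCast_iff]
    push_cast
    rw [ZMod.natCast_zmod_val]
    intro h
    have h' : g ^ e = 1 := Units.ext (by simpa using h)
    have := Nat.le_of_dvd h0 (orderOf_dvd_of_pow_eq_one h')
    omega

/-- Power sums with negative exponents modulo `p²`, by a Voronoi type congruence. -/
theorem sum_inv_pow_eq_bernoulli {p : ℕ} (hp : p.Prime) {e : ℕ} (h0 : 0 < e) (he : e < p - 1) :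
    ((e + 1 : ℕ) : ZMod (p ^ 2)) * ∑ j ∈ Finset.Ico 1 p, ((j : ZMod (p ^ 2))⁻¹) ^ e
      = (e : ZMod (p ^ 2)) * ((p : ZMod (p ^ 2)) * ratMod (p ^ 2) (bernoulli (p - 1 - e))) := by
  -- The choice of `m` makes m^(-e) - 1 a unit, to be cancelled at the end.
  obtain ⟨m, hm, hme⟩ := exists_pow_not_modEq_one hp h0 he
  have hϖ := natCast_self_sq p
  set ϖ : ZMod (p ^ 2) := (p : ZMod (p ^ 2)) with hϖdef
  have hunit : ∀ a : ℕ, ¬ p ∣ a → (a : ZMod (p ^ 2)) * (a : ZMod (p ^ 2))⁻¹ = 1 := fun a ha =>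
    ZMod.mul_inv_of_unit _ ((ZMod.isUnit_iff_coprime _ _).mpr
      (Nat.Coprime.pow_right 2 ((Nat.Prime.coprime_iff_not_dvd hp).mpr ha).symm))
  have hj : ∀ j ∈ Finset.Ico 1 p, ¬ p ∣ j := fun j hj => by
    rw [Finset.mem_Ico] at hj
    exact Nat.not_dvd_of_pos_of_lt hj.1 hj.2
  have hfermat : ∀ a : ℕ, ¬ p ∣ a → ϖ * (a : ZMod (p ^ 2)) ^ (p - 1) = ϖ := by
    intro a ha
    have h : a ^ (p - 1) ≡ 1 [MOD p] := by
      have := Nat.ModEq.pow_totient ((Nat.Prime.coprime_iff_not_dvd hp).mpr ha).symm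
      rwa [Nat.totient_prime hp] at this
    have := mul_natCast_eq_of_modEq h
    push_cast at this
    rw [this, mul_one]
  obtain ⟨k, hk⟩ : ∃ k, p - 1 - e = k + 1 := ⟨p - 2 - e, by omega⟩
  have hke : k + 1 + e = p - 1 := by omega
  set μ : ZMod (p ^ 2) := (m : ZMod (p ^ 2))
  set μ' : ZMod (p ^ 2) := (m : ZMod (p ^ 2))⁻¹
  have hμ : μ * μ' = 1 := hunit m hm
  set S := ∑ j ∈ Finset.Ico 1 p, ((j : ZMod (p ^ 2))⁻¹) ^ e
  set T := ∑ j ∈ Finset.Ico 1 p, (j : ZMod (p ^ 2)) ^ (k + 1)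
  -- Since jm mod p = jm - p⌊jm/p⌋, substituting it for j changes both power sums by multiples of
  -- this one first-order correction.
  set Q := ϖ * ∑ j ∈ Finset.Ico 1 p, ((j * m / p : ℕ) : ZMod (p ^ 2)) *
    ((j : ZMod (p ^ 2))⁻¹ * μ') ^ (e + 1)
  have hT : T = ϖ * ratMod (p ^ 2) (bernoulli (k + 1)) := by
    rw [← sum_range_pow_eq_bernoulli hp (by omega), Finset.range_eq_Ico,
      Finset.sum_eq_sum_Ico_succ_bot hp.pos]
    simp [T]
  have hmod : ∀ j : ℕ, ((j * m % p : ℕ) : ZMod (p ^ 2))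
      = j * μ - ϖ * ((j * m / p : ℕ) : ZMod (p ^ 2)) := by
    intro j
    have := congrArg (Nat.cast (R := ZMod (p ^ 2))) (Nat.mod_add_div (j * m) p)
    push_cast at this ⊢
    linear_combination this
  have hmodunit : ∀ j ∈ Finset.Ico 1 p, ¬ p ∣ j * m % p := by
    intro j hj' h
    rcases (hp.dvd_mul).mp ((Nat.dvd_mod_iff dvd_rfl).mp h) with h | h
    · exact hj j hj' h
    · exact hm h
  -- As k + (e+1) = p-1, Fermat identifies x^k with x^(-(e+1)) modulo p, and the factor ϖ makes that
  -- enough.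
  have hST : ∀ j ∈ Finset.Ico 1 p, ϖ * ((j : ZMod (p ^ 2)) * μ) ^ k
      = ϖ * ((j : ZMod (p ^ 2))⁻¹ * μ') ^ (e + 1) := by
    intro j hj'
    have h1 := hfermat j (hj j hj')
    have h2 := hfermat m hm
    have h3 := hunit j (hj j hj')
    have h4 : (((j : ZMod (p ^ 2)) * μ) * ((j : ZMod (p ^ 2))⁻¹ * μ')) ^ (e + 1) = 1 := by
      rw [show ((j : ZMod (p ^ 2)) * μ) * ((j : ZMod (p ^ 2))⁻¹ * μ')
        = (j * (j : ZMod (p ^ 2))⁻¹) * (μ * μ') by ring, h3, hμ]; simp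
    have h5 : ϖ * ((j : ZMod (p ^ 2)) * μ) ^ (k + (e + 1)) = ϖ := by
      rw [show k + (e + 1) = p - 1 by omega, mul_pow, ← mul_assoc, h1, h2]
    rw [mul_pow] at h4
    rw [pow_add] at h5
    linear_combination (-ϖ * ((j : ZMod (p ^ 2)) * μ) ^ k) * h4
      + (((j : ZMod (p ^ 2))⁻¹ * μ') ^ (e + 1)) * h5
  have hTeq : (μ ^ (k + 1) - 1) * T = (k + 1) * Q := by
    have h1 : T = ∑ j ∈ Finset.Ico 1 p, ((μ * j) ^ (k + 1)
        - (k + 1) * (((j * m / p : ℕ) : ZMod (p ^ 2)) *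
          (ϖ * ((j : ZMod (p ^ 2))⁻¹ * μ') ^ (e + 1)))) := by
      refine (sum_mul_mod hp hm fun j => (j : ZMod (p ^ 2)) ^ (k + 1)).symm.trans
        (Finset.sum_congr rfl fun j hj' => ?_)
      rw [hmod, sub_mul_pow hϖ, ← hST j hj']
      ring
    rw [Finset.sum_sub_distrib, ← Finset.mul_sum] at h1
    have h2 : ∑ j ∈ Finset.Ico 1 p, (μ * (j : ZMod (p ^ 2))) ^ (k + 1) = μ ^ (k + 1) * T := by
      rw [Finset.mul_sum]; exact Finset.sum_congr rfl fun j _ => mul_pow _ _ _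
    have h3 : Q = ∑ j ∈ Finset.Ico 1 p, (((j * m / p : ℕ) : ZMod (p ^ 2)) *
          (ϖ * ((j : ZMod (p ^ 2))⁻¹ * μ') ^ (e + 1))) := by
      refine (Finset.mul_sum _ _ _).trans (Finset.sum_congr rfl fun j _ => by ring)
    rw [h2, ← h3] at h1
    linear_combination -h1
  obtain ⟨e, rfl⟩ : ∃ e', e = e' + 1 := ⟨e - 1, by omega⟩
  have hSeq : (μ' ^ (e + 1) - 1) * S = -(e + 1) * Q := by
    have h1 : S = ∑ j ∈ Finset.Ico 1 p, ((μ' * (j : ZMod (p ^ 2))⁻¹) ^ (e + 1)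
        + (e + 1) * (ϖ * (((j * m / p : ℕ) : ZMod (p ^ 2)) *
          ((j : ZMod (p ^ 2))⁻¹ * μ') ^ (e + 1 + 1)))) := by
      refine (sum_mul_mod hp hm fun j => ((j : ZMod (p ^ 2))⁻¹) ^ (e + 1)).symm.trans
        (Finset.sum_congr rfl fun j hj' => ?_)
      have hu := hunit _ (hmodunit j hj')
      have h3 := hunit j (hj j hj')
      have hinv : ((j * m % p : ℕ) : ZMod (p ^ 2))⁻¹ = (j : ZMod (p ^ 2))⁻¹ * μ'
          - ϖ * (-(((j * m / p : ℕ) : ZMod (p ^ 2)) * ((j : ZMod (p ^ 2))⁻¹ * μ') ^ 2)) := by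
        rw [hmod] at hu ⊢
        generalize ((j : ZMod (p ^ 2)) * μ - ϖ * ((j * m / p : ℕ) : ZMod (p ^ 2)))⁻¹ = z at *
        generalize ((j * m / p : ℕ) : ZMod (p ^ 2)) = f at *
        generalize (j : ZMod (p ^ 2))⁻¹ = i at *
        have hji : (j : ZMod (p ^ 2)) * μ * (i * μ') = 1 := by
          linear_combination h3 * μ * μ' + hμ
        have hprod : ((j : ZMod (p ^ 2)) * μ - ϖ * f) * (i * μ' + ϖ * f * (i * μ') ^ 2) = 1 := by
          linear_combination (1 + ϖ * f * (i * μ')) * hji - f ^ 2 * (i * μ') ^ 2 * hϖ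
        linear_combination (i * μ' + ϖ * f * (i * μ') ^ 2) * hu - z * hprod
      rw [hinv, sub_mul_pow hϖ]
      ring
    rw [Finset.sum_add_distrib, ← Finset.mul_sum, ← Finset.mul_sum] at h1
    have h2 : ∑ j ∈ Finset.Ico 1 p, (μ' * (j : ZMod (p ^ 2))⁻¹) ^ (e + 1) = μ' ^ (e + 1) * S := by
      rw [Finset.mul_sum]; exact Finset.sum_congr rfl fun j _ => mul_pow _ _ _
    rw [h2] at h1
    linear_combination -h1
  have hpow : ϖ * μ ^ (k + 1) = ϖ * μ' ^ (e + 1) := by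
    have h1 := hfermat m hm
    rw [← hke, pow_add] at h1
    have h2 : μ ^ (e + 1) * μ' ^ (e + 1) = 1 := by rw [← mul_pow, hμ, one_pow]
    linear_combination (-ϖ * μ ^ (k + 1)) * h2 + μ' ^ (e + 1) * h1
  have hunit' : IsUnit (μ' ^ (e + 1) - 1) := by
    have h1 : IsUnit (((m ^ (e + 1) : ℕ) : ZMod (p ^ 2)) - 1) := by
      have hpos : 1 ≤ m ^ (e + 1) := Nat.one_le_pow _ _ (Nat.pos_of_ne_zero fun h => hm (by simp [h]))
      have : ((m ^ (e + 1) : ℕ) : ZMod (p ^ 2)) - 1 = ((m ^ (e + 1) - 1 : ℕ) : ZMod (p ^ 2)) := by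
        rw [Nat.cast_sub hpos, Nat.cast_one]
      rw [this, ZMod.isUnit_iff_coprime]
      refine Nat.Coprime.pow_right 2 ((Nat.Prime.coprime_iff_not_dvd hp).mpr fun h => ?_).symm
      exact hme ((Nat.modEq_iff_dvd' hpos).mpr h).symm
    have h2 : IsUnit (-(μ' ^ (e + 1))) := by
      refine (IsUnit.pow _ ?_).neg
      exact IsUnit.of_mul_eq_one μ (by rw [mul_comm, hμ])
    have h3 := h2.mul h1
    convert h3 using 1
    push_cast
    have h2 : μ ^ (e + 1) * μ' ^ (e + 1) = 1 := by rw [← mul_pow, hμ, one_pow]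
    linear_combination h2
  have hϖQ : ϖ * Q = 0 := by
    show ϖ * (ϖ * _) = 0
    rw [← mul_assoc, ← sq, hϖ, zero_mul]
  -- The summand ϖ is harmless: this factor multiplies Q, and ϖQ = 0.
  have hkcast : ((k : ZMod (p ^ 2)) + 1) = ϖ - 1 - (e + 1) := by
    have : (k + 1) + (e + 1) + 1 = p := by omega
    rw [hϖdef, ← this]; push_cast; ring
  rw [hk]
  refine hunit'.mul_left_cancel ?_
  rw [← hT]
  have hT' : (μ ^ (k + 1) - 1) * T = (μ' ^ (e + 1) - 1) * T := by
    rw [hT]; linear_combination ratMod (p ^ 2) (bernoulli (k + 1)) * hpow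
  rw [hT', hkcast] at hTeq
  push_cast
  linear_combination (e + 1 + 1) * hSeq - (e + 1) * hTeq - (e + 1) * hϖQ

/-! ### Power series congruent to 1 modulo ϖ, and Newton's identities -/

section NearOne
variable {B : Type*} [CommRing B]
open PowerSeries

/-- The power series `F` has constant coefficient `1`, and `ϖ` divides its coefficients of degrees
`1, …, D`. -/
def NearOne (ϖ : B) (D : ℕ) (F : B⟦X⟧) : Prop :=
  coeff 0 F = 1 ∧ ∀ d, 1 ≤ d → d ≤ D → ϖ ∣ coeff d F

variable {ϖ : B} {D : ℕ} {F G : B⟦X⟧}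

/-- Every mixed term contains ϖ², so multiplication becomes addition of coefficients. -/
theorem NearOne.coeff_mul (hϖ : ϖ ^ 2 = 0) (hF : NearOne ϖ D F) (hG : NearOne ϖ D G) {d : ℕ}
    (h1 : 1 ≤ d) (hd : d ≤ D) : coeff d (F * G) = coeff d F + coeff d G := by
  rw [PowerSeries.coeff_mul, Finset.sum_eq_add_of_mem (0, d) (d, 0) (by simp) (by simp)
    (by simp; omega), hF.1, hG.1, one_mul, mul_one, add_comm]
  rintro ⟨i, j⟩ hij ⟨h2, h3⟩
  have hij' := Finset.HasAntidiagonal.mem_antidiagonal.mp hij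
  simp only at hij'
  have hi : i ≠ 0 := by rintro rfl; exact h2 (by simp [← hij'])
  have hj : j ≠ 0 := by rintro rfl; exact h3 (by simp [← hij'])
  obtain ⟨a, ha⟩ := hF.2 i (by omega) (by omega)
  obtain ⟨b, hb⟩ := hG.2 j (by omega) (by omega)
  simp only [ha, hb]
  linear_combination (a * b) * hϖ

theorem NearOne.mul (hϖ : ϖ ^ 2 = 0) (hF : NearOne ϖ D F) (hG : NearOne ϖ D G) :
    NearOne ϖ D (F * G) := by
  refine ⟨by have h1 := hF.1; have h2 := hG.1; simp at h1 h2 ⊢; simp [h1, h2], fun d h1 hd => ?_⟩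
  rw [hF.coeff_mul hϖ hG h1 hd]
  exact dvd_add (hF.2 d h1 hd) (hG.2 d h1 hd)

theorem NearOne.of_mul_left (hG : NearOne ϖ D G) (hFG : NearOne ϖ D (F * G)) :
    NearOne ϖ D F := by
  refine ⟨?_, fun d h1 hd => ?_⟩
  · have h := hFG.1
    rw [PowerSeries.coeff_mul] at h
    simpa [show constantCoeff G = 1 by simpa using hG.1] using h
  · have h := hFG.2 d h1 hd
    rw [PowerSeries.coeff_mul, ← Finset.add_sum_erase _ _
      (show (d, 0) ∈ antidiagonal d by simp), hG.1, mul_one] at h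
    refine (dvd_add_left (Finset.dvd_sum ?_)).mp h
    rintro ⟨i, j⟩ hij
    obtain ⟨hne, hij'⟩ := Finset.mem_erase.mp hij
    have hij' := Finset.HasAntidiagonal.mem_antidiagonal.mp hij'
    simp only at hij'
    have hj : j ≠ 0 := by rintro rfl; exact hne (by simp [← hij'])
    exact (hG.2 j (by omega) (by omega)).mul_left _

/-- The logarithmic derivative of `∏ (1 - ρ_k² X)`. -/
theorem derivative_oneSubProd (ρ : ℕ → B) (n : ℕ) :
    derivative B (oneSubProd (X : B⟦X⟧) (fun k => C (ρ k)) n)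
      = -oneSubProd (X : B⟦X⟧) (fun k => C (ρ k)) n
        * PowerSeries.mk fun j => ∑ k ∈ Finset.range n, ρ (k + 1) ^ (2 * (j + 1)) := by
  induction n with
  | zero =>
    have : (PowerSeries.mk fun _ : ℕ => (0 : B)) = 0 := by ext; simp
    simp [oneSubProd, this]
  | succ n ih =>
    set a : B⟦X⟧ := C (ρ (n + 1) ^ 2)
    set M : B⟦X⟧ := PowerSeries.mk fun j => ∑ k ∈ Finset.range n, ρ (k + 1) ^ (2 * (j + 1))
    set E : B⟦X⟧ := PowerSeries.mk fun j => ρ (n + 1) ^ (2 * (j + 1))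
    have hE : E = a + a * X * E := by
      ext j
      cases j with
      | zero => simp [E, a]
      | succ j =>
        simp only [a, map_add, coeff_C, mul_assoc, coeff_C_mul, coeff_succ_X_mul, E, coeff_mk,
          Nat.succ_ne_zero, if_false]
        ring
    have hM : (PowerSeries.mk fun j => ∑ k ∈ Finset.range (n + 1), ρ (k + 1) ^ (2 * (j + 1)))
        = M + E := by
      ext j; simp [M, E, Finset.sum_range_succ]
    have hP := oneSubProd_succ (X : B⟦X⟧) (fun k => C (ρ k)) n
    have hfac : (1 - X * (C (ρ (n + 1))) ^ 2 : B⟦X⟧) = 1 - a * X := by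
      simp only [a, map_pow]; ring
    rw [hfac] at hP
    have hd : derivative B (1 - a * X) = -a := by
      simp [a]
    rw [hM, hP, Derivation.leibniz, ih, hd]
    simp only [smul_eq_mul]
    linear_combination (oneSubProd (X : B⟦X⟧) (fun k => C (ρ k)) n) * hE

theorem succ_mul_coeff_oneSubProd (ρ : ℕ → B) (n d : ℕ) :
    ((d : B) + 1) * coeff (d + 1) (oneSubProd (X : B⟦X⟧) (fun k => C (ρ k)) n)
      = -∑ q ∈ antidiagonal d, coeff q.1 (oneSubProd (X : B⟦X⟧) (fun k => C (ρ k)) n)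
          * ∑ k ∈ Finset.range n, ρ (k + 1) ^ (2 * (q.2 + 1)) := by
  have h := congrArg (coeff d) (derivative_oneSubProd ρ n)
  rw [coeff_derivative, neg_mul, map_neg, PowerSeries.coeff_mul] at h
  rw [mul_comm, h]
  simp

theorem coeff_zero_oneSubProd (ρ : ℕ → B) (n : ℕ) :
    coeff 0 (oneSubProd (X : B⟦X⟧) (fun k => C (ρ k)) n) = 1 := by
  simp [oneSubProd, map_prod]

theorem nearOne_oneSubProd {ρ : ℕ → B} {n : ℕ}
    (hunit : ∀ d : ℕ, 1 ≤ d → d ≤ D → IsUnit (d : B))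
    (hs : ∀ d, 1 ≤ d → d ≤ D → ϖ ∣ ∑ k ∈ Finset.range n, ρ (k + 1) ^ (2 * d)) :
    NearOne ϖ D (oneSubProd (X : B⟦X⟧) (fun k => C (ρ k)) n) := by
  refine ⟨coeff_zero_oneSubProd ρ n, fun d h1 hd => ?_⟩
  obtain ⟨d, rfl⟩ : ∃ e, d = e + 1 := ⟨d - 1, by omega⟩
  have hu := hunit (d + 1) h1 hd
  push_cast at hu
  rw [← hu.dvd_mul_left, succ_mul_coeff_oneSubProd]
  refine (dvd_neg.mpr (Finset.dvd_sum fun q hq => ?_))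
  have := Finset.HasAntidiagonal.mem_antidiagonal.mp hq
  exact (hs _ (by omega) (by omega)).mul_left _

/-- In Newton's identity only the term with the constant coefficient survives; the others are
products of two multiples of ϖ. -/
theorem mul_coeff_oneSubProd (hϖ : ϖ ^ 2 = 0) {ρ : ℕ → B} {n : ℕ}
    (hunit : ∀ d : ℕ, 1 ≤ d → d ≤ D → IsUnit (d : B))
    (hs : ∀ d, 1 ≤ d → d ≤ D → ϖ ∣ ∑ k ∈ Finset.range n, ρ (k + 1) ^ (2 * d)) {d : ℕ}
    (h1 : 1 ≤ d) (hd : d ≤ D) :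
    (d : B) * coeff d (oneSubProd (X : B⟦X⟧) (fun k => C (ρ k)) n)
      = -∑ k ∈ Finset.range n, ρ (k + 1) ^ (2 * d) := by
  have hnear := nearOne_oneSubProd hunit hs
  obtain ⟨d, rfl⟩ : ∃ e, d = e + 1 := ⟨d - 1, by omega⟩
  push_cast
  rw [succ_mul_coeff_oneSubProd, ← Finset.add_sum_erase _ _
    (show (0, d) ∈ antidiagonal d by simp), coeff_zero_oneSubProd, one_mul, Finset.sum_eq_zero (s := Finset.erase _ _),
    add_zero]
  rintro ⟨i, j⟩ hij
  obtain ⟨hne, hij'⟩ := Finset.mem_erase.mp hij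
  have hij' := Finset.HasAntidiagonal.mem_antidiagonal.mp hij'
  simp only at hij'
  have hi : i ≠ 0 := by rintro rfl; exact hne (by simp [← hij'])
  obtain ⟨a, ha⟩ := hnear.2 i (by omega) (by omega)
  obtain ⟨b, hb⟩ := hs (j + 1) (by omega) (by omega)
  simp only [ha, hb]
  linear_combination (a * b) * hϖ

theorem oneSubProd_C_mul_X {K : Type*} [CommRing K] (φ : K →+* B) (c : B) (ρ : ℕ → K) (n : ℕ) :
    oneSubProd (C c * X) (fun k => C (φ (ρ k))) n
      = rescale c (PowerSeries.map φ (oneSubProd (X : K⟦X⟧) (fun k => C (ρ k)) n)) := by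
  have h1 : ∀ a : B, rescale c (C a) = C a := by
    intro a; ext j; cases j <;> simp [coeff_rescale, coeff_C]
  simp only [oneSubProd, map_prod, map_sub, map_one, map_mul, map_pow, PowerSeries.map_X,
    PowerSeries.map_C, h1, rescale_X]

theorem coeff_oneSubProd_C_mul_X {K : Type*} [CommRing K] (φ : K →+* B) (c : B) (ρ : ℕ → K)
    (n d : ℕ) :
    coeff d (oneSubProd (C c * X) (fun k => C (φ (ρ k))) n)
      = c ^ d * φ (coeff d (oneSubProd (X : K⟦X⟧) (fun k => C (ρ k)) n)) := by
  rw [oneSubProd_C_mul_X, coeff_rescale, coeff_map]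

end NearOne

/-! ### Expansions in powers of T and T² + 1 -/

section PolynomialIdentities
variable {B : Type*} [CommRing B]

theorem add_pow_add_neg_add_pow (u v : B) (d : ℕ) :
    (v + u) ^ d + (-v + u) ^ d = ∑ q ∈ antidiagonal d,
      if Even q.1 then 2 * (d.choose q.1 : B) * u ^ q.2 * v ^ q.1 else 0 := by
  rw [(Commute.all v u).add_pow', (Commute.all (-v) u).add_pow', ← Finset.sum_add_distrib]
  refine Finset.sum_congr rfl fun q _ => ?_
  split_ifs with h
  · rw [h.neg_pow, nsmul_eq_mul]; ring
  · rw [(Nat.not_even_iff_odd.mp h).neg_pow, nsmul_eq_mul, nsmul_eq_mul]; ring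

/-- The coefficients of the expression of a complete homogeneous symmetric polynomial in two
variables by elementary symmetric polynomials. -/
def hCoeff (L m : ℕ) : ℤ := if Even L then (-1) ^ (L / 2) * ((L / 2 + m).choose (L / 2) : ℤ) else 0

theorem hCoeff_zero_left (m : ℕ) : hCoeff 0 m = 1 := by simp [hCoeff]

theorem hCoeff_one_left (m : ℕ) : hCoeff 1 m = 0 := by simp [hCoeff]

theorem hCoeff_add_two_zero (L : ℕ) : hCoeff (L + 2) 0 = -hCoeff L 0 := by
  simp [hCoeff, Nat.even_add, pow_succ]
  split_ifs <;> simp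

theorem hCoeff_add_two_succ (L m : ℕ) :
    hCoeff (L + 2) (m + 1) = hCoeff (L + 2) m - hCoeff L (m + 1) := by
  have h2 : (L + 2) / 2 = L / 2 + 1 := by omega
  simp only [hCoeff, Nat.even_add, even_two, iff_true, h2]
  split_ifs
  · have := Nat.choose_succ_succ (L / 2 + (m + 1)) (L / 2)
    rw [show L / 2 + 1 + (m + 1) = (L / 2 + (m + 1)) + 1 by ring, this,
      show L / 2 + 1 + m = L / 2 + (m + 1) by ring]
    push_cast
    ring
  · simp

/-- The complete homogeneous sum in terms of elementary symmetric polynomials. -/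
def hSum (u v : B) (d : ℕ) : B :=
  ∑ q ∈ antidiagonal d, (hCoeff q.1 q.2 : B) * u ^ q.2 * v ^ q.1

/-- Pascal's rule for `hCoeff`. This is the recurrence of the complete homogeneous polynomials in
two quantities with sum u and product v². -/
theorem hSum_add_two (u v : B) (d : ℕ) :
    hSum u v (d + 2) = u * hSum u v (d + 1) - v ^ 2 * hSum u v d := by
  rw [hSum, Finset.Nat.sum_antidiagonal_succ, Finset.Nat.sum_antidiagonal_succ,
    hSum, Finset.Nat.sum_antidiagonal_succ, hSum]
  simp only [zero_add, hCoeff_zero_left, hCoeff_one_left, add_assoc, Nat.reduceAdd, Int.cast_zero,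
    zero_mul, Int.cast_one]
  cases d with
  | zero => simp [hCoeff]; ring
  | succ d =>
    rw [Finset.Nat.sum_antidiagonal_succ', Finset.Nat.sum_antidiagonal_succ,
      Finset.Nat.sum_antidiagonal_succ' (f := fun q : ℕ × ℕ => (hCoeff q.1 q.2 : B) * u ^ q.2 * v ^ q.1)]
    simp only [hCoeff_add_two_zero, hCoeff_add_two_succ, hCoeff_one_left, add_assoc, Nat.reduceAdd]
    push_cast
    simp only [sub_mul, Finset.sum_sub_distrib, mul_add, Finset.mul_sum]
    ring_nf

/-- The case where the two quantities are v² and 1. -/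
theorem geom_sum_eq_hSum (v : B) (d : ℕ) :
    ∑ i ∈ Finset.range (d + 1), (v ^ 2) ^ i = hSum (v ^ 2 + 1) v d := by
  induction d using Nat.twoStepInduction with
  | zero => simp [hSum, hCoeff]
  | one =>
    rw [hSum, Finset.Nat.sum_antidiagonal_succ]
    simp [hCoeff, Finset.sum_range_succ]; ring
  | more d h1 h2 =>
    rw [hSum_add_two, ← h1, ← h2, Finset.sum_range_succ, Finset.sum_range_succ]
    ring

open Polynomial in
-- The system is triangular: X² + 1 has constant term 1, so once the smaller exponents are gone the
-- coefficient of X^L is c L m.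
theorem eq_zero_of_sum_pow_mul_X_pow (c : ℕ → ℕ → B) (d : ℕ)
    (h : ∑ q ∈ antidiagonal d, C (c q.1 q.2) * (X ^ 2 + 1) ^ q.2 * X ^ q.1 = 0) (L m : ℕ)
    (hLm : L + m = d) : c L m = 0 := by
  induction L using Nat.strong_induction_on generalizing m with
  | _ L ih =>
    have hc := congrArg (fun f : B[X] => f.coeff L) h
    simp only [Polynomial.finsetSum_coeff, Polynomial.coeff_mul_X_pow', Polynomial.coeff_C_mul,
      Polynomial.coeff_zero] at hc
    rw [Finset.sum_eq_single (L, m)] at hc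
    · simpa [Polynomial.coeff_zero_eq_eval_zero] using hc
    · rintro ⟨i, j⟩ hij hne
      have hij' := Finset.HasAntidiagonal.mem_antidiagonal.mp hij
      simp only at hij'
      rcases lt_trichotomy i L with hi | hi | hi
      · simp [ih i hi j hij']
      · subst hi
        exact absurd (by rw [show j = m by omega]) hne
      · simp [not_le.mpr hi]
    · intro hn
      exact absurd (Finset.HasAntidiagonal.mem_antidiagonal.mpr hLm) hn

end PolynomialIdentities

/-! ### The coefficients of A modulo p² -/

section InversePowers
variable {p : ℕ}

theorem ratMod_bernoulli_div (hp : p.Prime) {k : ℕ} (h1 : 1 < k) (hk : k < p) :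
    ratMod (p ^ 2) (bernoulli (p - k) / k) * (k : ZMod (p ^ 2)) = ratMod (p ^ 2) (bernoulli (p - k)) := by
  have hu := isUnit_natCast_of_lt hp 2 (by omega) hk
  have hinv := ModIntegral.inv_natCast (N := p ^ 2) (a := k) (by omega) hu
  rw [div_eq_mul_inv, ratMod_mul (modIntegral_bernoulli hp 2 (by omega)) hinv.1, hinv.2, mul_assoc,
    ZMod.inv_mul_of_unit _ hu, mul_one]

theorem sum_inv_pow (hp : p.Prime) {d : ℕ} (h1 : 1 ≤ d) (hd : 2 * d + 1 < p) :
    ∑ k ∈ Finset.range (p - 1), (((k + 1 : ℕ) : ZMod (p ^ 2))⁻¹) ^ (2 * d)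
      = (d : ZMod (p ^ 2)) * (2 * ((p : ZMod (p ^ 2)) *
        ratMod (p ^ 2) (bernoulli (p - (2 * d + 1)) / (2 * d + 1 : ℕ)))) := by
  have h := sum_inv_pow_eq_bernoulli hp (e := 2 * d) (by omega) (by omega)
  rw [Finset.sum_Ico_eq_sum_range, show p - 1 - 2 * d = p - (2 * d + 1) by omega,
    ← ratMod_bernoulli_div hp (by omega) hd] at h
  refine (isUnit_natCast_of_lt hp 2 (by omega) hd).mul_left_cancel ?_
  simp only [add_comm 1] at h
  rw [h]
  push_cast
  ring

theorem isUnit_natCast_of_le (hp : p.Prime) {D : ℕ} (hD : 2 * D + 1 < p) (d : ℕ) (h1 : 1 ≤ d)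
    (hd : d ≤ D) : IsUnit (d : ZMod (p ^ 2)) :=
  isUnit_natCast_of_lt hp 2 (by omega) (by omega)

theorem dvd_sum_inv_pow (hp : p.Prime) {D : ℕ} (hD : 2 * D + 1 < p) (d : ℕ) (h1 : 1 ≤ d)
    (hd : d ≤ D) : (p : ZMod (p ^ 2)) ∣
      ∑ k ∈ Finset.range (p - 1), (((k + 1 : ℕ) : ZMod (p ^ 2))⁻¹) ^ (2 * d) := by
  rw [sum_inv_pow hp h1 (by omega)]
  exact ((dvd_mul_right _ _).mul_left _).mul_left _

/-- The coefficients of `∏_{k < p} (1 - X / k²)` modulo `p²`. -/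
noncomputable def invSqCoeff (p d : ℕ) : ZMod (p ^ 2) :=
  PowerSeries.coeff d (oneSubProd (PowerSeries.X : PowerSeries (ZMod (p ^ 2)))
    (fun k => PowerSeries.C ((k : ZMod (p ^ 2))⁻¹)) (p - 1))

theorem invSqCoeff_zero (p : ℕ) : invSqCoeff p 0 = 1 := coeff_zero_oneSubProd _ _

theorem invSqCoeff_eq (hp : p.Prime) {d : ℕ} (h1 : 1 ≤ d) (hd : 2 * d + 1 < p) :
    invSqCoeff p d = -(2 * ((p : ZMod (p ^ 2)) *
        ratMod (p ^ 2) (bernoulli (p - (2 * d + 1)) / (2 * d + 1 : ℕ)))) := by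
  refine (isUnit_natCast_of_lt hp 2 h1 (by omega)).mul_left_cancel ?_
  rw [invSqCoeff, mul_coeff_oneSubProd (natCast_self_sq p) (isUnit_natCast_of_le hp hd)
    (dvd_sum_inv_pow hp hd) h1 le_rfl, sum_inv_pow hp h1 hd]
  ring

theorem natCast_dvd_invSqCoeff (hp : p.Prime) {d : ℕ} (h1 : 1 ≤ d) (hd : 2 * d + 1 < p) :
    (p : ZMod (p ^ 2)) ∣ invSqCoeff p d := by
  rw [invSqCoeff_eq hp h1 hd]
  exact (dvd_neg.mpr ((dvd_mul_right _ _).mul_left _))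

end InversePowers

/-! ### The transfer product of the inverses modulo p² -/

section Evaluation
open PowerSeries
variable {p : ℕ}

/-- The inverses of `1, …, p - 1` modulo `p²`. -/
noncomputable def invList (p : ℕ) : List (ZMod (p ^ 2)) :=
  (List.range' 1 (p - 1)).map fun k : ℕ => (k : ZMod (p ^ 2))⁻¹

/-- The `k`-th inverse modulo `p²`, as a power series over the polynomial ring. -/
noncomputable def invSeries (p k : ℕ) : PowerSeries (Polynomial (ZMod (p ^ 2))) :=
  C (Polynomial.C ((k : ZMod (p ^ 2))⁻¹))

theorem map_invList (p : ℕ) : ((invList p).map Polynomial.C).map C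
    = (List.range' 1 (p - 1)).map (invSeries p) := by
  simp [invList, invSeries, Function.comp_def]

theorem coeff_oneSubProd_invSeries (c : Polynomial (ZMod (p ^ 2))) (d : ℕ) :
    coeff d (oneSubProd (C c * X) (invSeries p) (p - 1))
      = c ^ d * Polynomial.C (invSqCoeff p d) :=
  coeff_oneSubProd_C_mul_X Polynomial.C c _ _ d

theorem list_prod_eq_oneSubProd {R : Type*} [CommRing R] (Y : R) (ρ : ℕ → R) (n : ℕ) :
    (((List.range' 1 n).map ρ).map fun r => 1 + -Y * r ^ 2).prod = oneSubProd Y ρ n := by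
  induction n with
  | zero => simp [oneSubProd]
  | succ n ih =>
    rw [List.range'_1_concat, List.map_append, List.map_append, List.prod_append, ih,
      oneSubProd_succ, add_comm 1 n]
    simp
    ring

theorem nearOne_oneSubProd_invSeries (hp : p.Prime) {D : ℕ} (hD : 2 * D + 1 < p)
    (c : Polynomial (ZMod (p ^ 2))) :
    NearOne (Polynomial.C (p : ZMod (p ^ 2))) D
      (oneSubProd (C c * X) (invSeries p) (p - 1)) := by
  refine ⟨by rw [coeff_oneSubProd_invSeries, invSqCoeff_zero]; simp, fun d h1 hd => ?_⟩
  rw [coeff_oneSubProd_invSeries]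
  exact (map_dvd Polynomial.C (natCast_dvd_invSqCoeff hp h1 (by omega))).mul_left _

/-- The transfer product modulo `p²`. -/
noncomputable def primeTransfer (p : ℕ) :
    Matrix (Fin 2) (Fin 2) (PowerSeries (Polynomial (ZMod (p ^ 2)))) :=
  transferProd (-(C (Polynomial.X ^ 2 + 1) * X)) (C (2 * Polynomial.X) * X)
    ((List.range' 1 (p - 1)).map (invSeries p))

theorem natCast_mul_invSeries (hp : p.Prime) {k : ℕ} (h1 : 1 ≤ k) (hk : k < p) :
    (k : PowerSeries (Polynomial (ZMod (p ^ 2)))) * invSeries p k = 1 := by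
  have h := ZMod.mul_inv_of_unit _ (isUnit_natCast_of_lt hp 2 h1 hk)
  have h' := congrArg (fun a => (C (Polynomial.C a) : PowerSeries (Polynomial (ZMod (p ^ 2))))) h
  simpa [invSeries] using h'

theorem natCast_self_sq_powerSeries (p : ℕ) :
    (p : PowerSeries (Polynomial (ZMod (p ^ 2)))) ^ 2 = 0 := by
  have h := congrArg (fun a => (C (Polynomial.C a) : PowerSeries (Polynomial (ZMod (p ^ 2)))))
    (natCast_self_sq p)
  simpa using h

theorem primeTransfer_one_one (hp : p.Prime) :
    primeTransfer p 1 1 = PowerSeries.mk fun d =>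
      Polynomial.C (invSqCoeff p d) * ∑ i ∈ Finset.range (d + 1), (Polynomial.X ^ 2) ^ i := by
  set T : Polynomial (ZMod (p ^ 2)) := Polynomial.X
  have hN : p - 1 + 1 = p := Nat.succ_pred_prime hp
  have hT : (C (2 * T) * X : PowerSeries (Polynomial (ZMod (p ^ 2)))) = 2 * (C T * X) := by
    rw [map_mul, map_ofNat, mul_assoc]
  have hξ : (-(C (T ^ 2 + 1) * X) : PowerSeries (Polynomial (ZMod (p ^ 2))))
      = -(C (T ^ 2) * X + C 1 * X) := by rw [map_add, add_mul]
  have hone : (1 : Polynomial (ZMod (p ^ 2))) - T ^ 2 = -(T ^ 2 - Polynomial.C 1) := by simp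
  have hWZ : (C 1 * X - C (T ^ 2) * X : PowerSeries (Polynomial (ZMod (p ^ 2))))
      = X * C (1 - T ^ 2) := by rw [map_sub]; ring
  -- The coefficient ring has zero divisors; W-Z = X(1-T²) is regular because T²-1 is monic.
  have hreg : ∀ a : PowerSeries (Polynomial (ZMod (p ^ 2))),
      (C 1 * X - C (T ^ 2) * X) * a = 0 → a = 0 := by
    intro a ha
    ext1 d
    have := congrArg (coeff (d + 1)) ha
    rw [hWZ, mul_assoc, coeff_succ_X_mul, coeff_C_mul, hone, neg_mul, map_zero, neg_eq_zero] at this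
    rw [map_zero]
    exact (Polynomial.monic_X_pow_sub_C (1 : ZMod (p ^ 2)) two_ne_zero).mul_right_eq_zero_iff.mp this
  -- With Z = T²X, W = X and q = TX, the weights -(Z+W) and 2q are those of `primeTransfer`.
  have key := sub_mul_transferProd_reflect (N := p - 1) (Z := C (T ^ 2) * X) (W := C 1 * X)
    (q := C T * X) (by rw [hN]; exact natCast_self_sq_powerSeries p)
    (by rw [map_pow, map_one]; ring) (r := invSeries p)
    (fun k hk => natCast_mul_invSeries hp (by omega) (by omega)) hreg
  rw [← hξ, ← hT] at key
  refine sub_eq_zero.mp (hreg _ ?_)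
  rw [mul_sub, sub_eq_zero]
  refine key.trans ?_
  rw [hWZ]
  ext1 d
  cases d with
  | zero => simp
  | succ d =>
    rw [map_sub, mul_assoc, mul_assoc, mul_assoc, coeff_C_mul, coeff_C_mul, coeff_succ_X_mul,
      coeff_succ_X_mul, coeff_succ_X_mul, coeff_C_mul, coeff_mk, coeff_oneSubProd_invSeries,
      coeff_oneSubProd_invSeries]
    have := geom_sum_mul (T ^ 2) (d + 1)
    rw [one_pow]
    linear_combination (Polynomial.C (invSqCoeff p d)) * this

theorem coeff_primeTransfer_one_one (hp : p.Prime) (d : ℕ) :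
    coeff d (primeTransfer p 1 1) = Polynomial.C (invSqCoeff p d)
      * ∑ i ∈ Finset.range (d + 1), (Polynomial.X ^ 2) ^ i := by
  rw [primeTransfer_one_one hp, coeff_mk]

theorem nearOne_primeTransfer_one_one (hp : p.Prime) {D : ℕ} (hD : 2 * D + 1 < p) :
    NearOne (Polynomial.C (p : ZMod (p ^ 2))) D (primeTransfer p 1 1) := by
  refine ⟨by rw [coeff_primeTransfer_one_one hp, invSqCoeff_zero]; simp, fun d h1 hd => ?_⟩
  rw [coeff_primeTransfer_one_one hp]
  exact (map_dvd Polynomial.C (natCast_dvd_invSqCoeff hp h1 (by omega))).mul_right _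

theorem det_primeTransfer_eq_oneSubProd (p : ℕ) : (primeTransfer p).det
    = oneSubProd (C ((2 * Polynomial.X + (Polynomial.X ^ 2 + 1))) * X) (invSeries p) (p - 1)
      * oneSubProd (C ((-(2 * Polynomial.X) + (Polynomial.X ^ 2 + 1))) * X) (invSeries p) (p - 1) := by
  rw [primeTransfer, det_transferProd, ← list_prod_eq_oneSubProd, ← list_prod_eq_oneSubProd]
  congr! 5 with r <;> simp only [map_add, map_neg] <;> ring

theorem isUnit_two (hp : p.Prime) (h2 : 2 < p) :
    IsUnit (2 : PowerSeries (Polynomial (ZMod (p ^ 2)))) := by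
  have h := isUnit_natCast_of_lt hp 2 (by norm_num) h2
  have h' := h.map ((C (R := Polynomial (ZMod (p ^ 2)))).comp Polynomial.C)
  rwa [Nat.cast_ofNat, map_ofNat] at h'

theorem det_primeTransfer (hp : p.Prime) (h2 : 2 < p) :
    (primeTransfer p).det = primeTransfer p 0 0 * primeTransfer p 1 1 := by
  refine det_transferProd_of_reverse (p : PowerSeries (Polynomial (ZMod (p ^ 2))))
    (natCast_self_sq_powerSeries p) (isUnit_two hp h2) _ _ _ ?_
  rw [← List.map_reverse, List.reverse_range', List.map_map, List.map_map, List.map_map]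
  refine List.ext_getElem (by simp) fun i h1 _ => ?_
  simp only [List.getElem_map, Function.comp_apply, List.getElem_range, List.getElem_range',
    one_mul]
  simp only [List.length_map, List.length_range] at h1
  rw [Ideal.Quotient.eq, Ideal.mem_span_singleton, sub_neg_eq_add]
  have e : 1 + (p - 1) - 1 - i = p - (1 + i) := by omega
  rw [e]
  have h3 := natCast_mul_invSeries hp (k := 1 + i) (by omega) (by omega)
  have h4 := natCast_mul_invSeries hp (k := p - (1 + i)) (by omega) (by omega)
  rw [Nat.cast_sub (by omega)] at h4
  -- This is 1/k + 1/(p-k) = p/(k(p-k)).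
  refine ⟨invSeries p (1 + i) * invSeries p (p - (1 + i)), ?_⟩
  linear_combination (-invSeries p (p - (1 + i))) * h3 - invSeries p (1 + i) * h4

theorem polynomial_C_natCast_self_sq (p : ℕ) :
    (Polynomial.C (p : ZMod (p ^ 2))) ^ 2 = 0 := by
  rw [← map_pow, natCast_self_sq, map_zero]

theorem nearOne_det_primeTransfer (hp : p.Prime) {D : ℕ} (hD : 2 * D + 1 < p) :
    NearOne (Polynomial.C (p : ZMod (p ^ 2))) D (primeTransfer p).det := by
  rw [det_primeTransfer_eq_oneSubProd]
  exact (nearOne_oneSubProd_invSeries hp hD _).mul (polynomial_C_natCast_self_sq p)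
    (nearOne_oneSubProd_invSeries hp hD _)

theorem coeff_det_primeTransfer (hp : p.Prime) {d : ℕ} (h1 : 1 ≤ d) (hd : 2 * d + 1 < p) :
    coeff d (primeTransfer p).det = Polynomial.C (invSqCoeff p d) *
      ((2 * Polynomial.X + (Polynomial.X ^ 2 + 1)) ^ d
        + (-(2 * Polynomial.X) + (Polynomial.X ^ 2 + 1)) ^ d) := by
  rw [det_primeTransfer_eq_oneSubProd, (nearOne_oneSubProd_invSeries hp hd _).coeff_mul
    (polynomial_C_natCast_self_sq p) (nearOne_oneSubProd_invSeries hp hd _) h1 le_rfl,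
    coeff_oneSubProd_invSeries, coeff_oneSubProd_invSeries]
  ring

theorem nearOne_primeTransfer_zero_zero (hp : p.Prime) (h2 : 2 < p) {D : ℕ} (hD : 2 * D + 1 < p) :
    NearOne (Polynomial.C (p : ZMod (p ^ 2))) D (primeTransfer p 0 0) :=
  (nearOne_primeTransfer_one_one hp hD).of_mul_left
    (det_primeTransfer hp h2 ▸ nearOne_det_primeTransfer hp hD)

theorem coeff_insSeries_nestedSum (hp : p.Prime) {d : ℕ} (h1 : 1 ≤ d) (hd : 2 * d + 1 < p) :
    coeff d (insSeries (-(Polynomial.X ^ 2 + 1)) (2 * Polynomial.X)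
        (nestedSum ((invList p).map Polynomial.C)) 0)
      = Polynomial.C (invSqCoeff p d) *
        ((2 * Polynomial.X + (Polynomial.X ^ 2 + 1)) ^ d
          + (-(2 * Polynomial.X) + (Polynomial.X ^ 2 + 1)) ^ d
          - ∑ i ∈ Finset.range (d + 1), (Polynomial.X ^ 2) ^ i) := by
  have h2 : 2 < p := by omega
  have hmul := (nearOne_primeTransfer_zero_zero hp h2 hd).coeff_mul
    (polynomial_C_natCast_self_sq p) (nearOne_primeTransfer_one_one hp hd) h1 le_rfl
  rw [← det_primeTransfer hp h2, coeff_det_primeTransfer hp h1 hd,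
    coeff_primeTransfer_one_one hp] at hmul
  have hT := (insSeries_nestedSum_eq_transferProd (-(Polynomial.X ^ 2 + 1)) (2 * Polynomial.X)
    ((invList p).map Polynomial.C)).1
  rw [map_invList, map_neg, neg_mul] at hT
  rw [hT]
  change coeff d (primeTransfer p 0 0) = _
  linear_combination -hmul

/-- With S the star series, S·det P = P₀₀ and P₀₀P₁₁ = det P. Linearised, these make the
coefficients of S and P₁₁ opposite. -/
theorem coeff_insSeries_nestedSumStar (hp : p.Prime) {d : ℕ} (h1 : 1 ≤ d) (hd : 2 * d + 1 < p) :
    coeff d (insSeries (Polynomial.X ^ 2 + 1) (2 * Polynomial.X)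
        (nestedSumStar ((invList p).map Polynomial.C)) 0)
      = -(Polynomial.C (invSqCoeff p d) *
        ∑ i ∈ Finset.range (d + 1), (Polynomial.X ^ 2) ^ i) := by
  have h2 : 2 < p := by omega
  have hϖ := polynomial_C_natCast_self_sq p
  have h00 := nearOne_primeTransfer_zero_zero hp h2 hd
  have h11 := nearOne_primeTransfer_one_one hp hd
  have hdet := nearOne_det_primeTransfer hp hd
  have hT := (insSeries_nestedSumStar_mul_det (Polynomial.X ^ 2 + 1) (2 * Polynomial.X)
    ((invList p).map Polynomial.C)).1
  rw [map_invList] at hT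
  change _ * (primeTransfer p).det = primeTransfer p 0 0 at hT
  have hS := hdet.of_mul_left (hT ▸ h00)
  have e1 := hS.coeff_mul hϖ hdet h1 le_rfl
  have e2 := h00.coeff_mul hϖ h11 h1 le_rfl
  rw [hT] at e1
  rw [← det_primeTransfer hp h2, coeff_primeTransfer_one_one hp] at e2
  linear_combination -e1 - e2

end Evaluation

/-! ### Extraction of the individual sums -/

theorem map_nestedSum {R S : Type*} [CommSemiring R] [CommSemiring S] (φ : R →+* S) (rs : List R) (k : List ℕ) :
    nestedSum (rs.map φ) k = φ (nestedSum rs k) := by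
  induction rs generalizing k with
  | nil => cases k <;> simp
  | cons r rs ih =>
    cases k with
    | nil => simp
    | cons c k => simp [nestedSum_cons_cons, ih]

theorem map_nestedSumStar {R S : Type*} [CommSemiring R] [CommSemiring S] (φ : R →+* S)
    (rs : List R) (k : List ℕ) :
    nestedSumStar (rs.map φ) k = φ (nestedSumStar rs k) := by
  induction rs generalizing k with
  | nil => cases k <;> simp
  | cons r rs ih =>
    induction k with
    | nil => simp
    | cons c k ihk =>
      rw [List.map_cons] at ihk ⊢
      rw [nestedSumStar_cons_cons, nestedSumStar_cons_cons, ih, ihk]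
      simp

theorem map_insSum {R S : Type*} [CommRing R] [CommRing S] (φ : R →+* S) (Φ : List ℕ → R)
    (b L m : ℕ) : insSum (fun k => φ (Φ k)) b L m = φ (insSum Φ b L m) := by
  simp [insSum]

theorem insSum_nestedSum_eq {p : ℕ} (hp : p.Prime) {l m : ℕ} (h1 : 1 ≤ 2 * l + m)
    (hd : 2 * (2 * l + m) + 1 < p) :
    4 ^ l * insSum (nestedSum (invList p)) 0 (2 * l) m
      = (-1) ^ m * invSqCoeff p (2 * l + m) *
        (2 * 4 ^ l * ((2 * l + m).choose (2 * l) : ZMod (p ^ 2))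
          - (-1) ^ l * ((l + m).choose l : ZMod (p ^ 2))) := by
  have h := coeff_insSeries_nestedSum hp h1 hd
  rw [add_pow_add_neg_add_pow, geom_sum_eq_hSum, insSeries, PowerSeries.coeff_mk, hSum,
    ← Finset.sum_sub_distrib, Finset.mul_sum, ← sub_eq_zero, ← Finset.sum_sub_distrib] at h
  -- Odd L occurs on neither side. For L = 2l the letter weight (2T)^L supplies the factor 4^l, and
  -- (-1)^m comes from the weight -(T²+1) of the twos.
  have key := eq_zero_of_sum_pow_mul_X_pow (fun L m => if Even L then
      (-1) ^ m * (2 ^ L * insSum (nestedSum (invList p)) 0 L m)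
        - invSqCoeff p (L + m) * (2 * ((L + m).choose L : ZMod (p ^ 2)) * 2 ^ L - (hCoeff L m : ZMod (p ^ 2)))
      else 0) (2 * l + m) ?_ (2 * l) m rfl
  · simp only [even_two.mul_right, if_true, pow_mul, hCoeff, Nat.mul_div_cancel_left l two_pos] at key
    norm_num at key
    have hm : ((-1 : ZMod (p ^ 2)) ^ m) ^ 2 = 1 := by rw [← pow_mul, mul_comm, pow_mul]; simp
    linear_combination (-1) ^ m * key - (4 ^ l * insSum (nestedSum (invList p)) 0 (2 * l) m) * hm
  · rw [← h]
    refine Finset.sum_congr rfl fun q hq => ?_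
    have hq' := Finset.HasAntidiagonal.mem_antidiagonal.mp hq
    simp only [funext (map_nestedSum (Polynomial.C (R := ZMod (p ^ 2))) (invList p)), map_insSum,
      add_zero, hq']
    by_cases he : Even q.1
    · simp only [he, if_true, map_sub, map_mul, map_pow, map_neg, map_one, map_ofNat, map_natCast,
        map_intCast]
      rw [neg_pow (Polynomial.X ^ 2 + 1 : Polynomial (ZMod (p ^ 2)))]
      ring
    · simp [he, hCoeff]

theorem insSum_nestedSumStar_eq {p : ℕ} (hp : p.Prime) {l m : ℕ} (h1 : 1 ≤ 2 * l + m)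
    (hd : 2 * (2 * l + m) + 1 < p) :
    4 ^ l * insSum (nestedSumStar (invList p)) 0 (2 * l) m
      = -(invSqCoeff p (2 * l + m) * ((-1) ^ l * ((l + m).choose l : ZMod (p ^ 2)))) := by
  have h := coeff_insSeries_nestedSumStar hp h1 hd
  rw [geom_sum_eq_hSum, insSeries, PowerSeries.coeff_mk, hSum,
    Finset.mul_sum, ← sub_eq_zero, sub_neg_eq_add, ← Finset.sum_add_distrib] at h
  have key := eq_zero_of_sum_pow_mul_X_pow (fun L m => if Even L then
      2 ^ L * insSum (nestedSumStar (invList p)) 0 L m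
        + invSqCoeff p (L + m) * (hCoeff L m : ZMod (p ^ 2))
      else 0) (2 * l + m) ?_ (2 * l) m rfl
  · simp only [even_two.mul_right, if_true, pow_mul, hCoeff, Nat.mul_div_cancel_left l two_pos] at key
    norm_num at key
    linear_combination key
  · rw [← h]
    refine Finset.sum_congr rfl fun q hq => ?_
    have hq' := Finset.HasAntidiagonal.mem_antidiagonal.mp hq
    simp only [funext (map_nestedSumStar (Polynomial.C (R := ZMod (p ^ 2))) (invList p)), map_insSum,
      add_zero, hq']
    by_cases he : Even q.1
    · simp only [he, if_true, map_add, map_mul, map_pow, map_ofNat, map_intCast]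
      ring
    · simp [he, hCoeff]

theorem isUnit_four_pow {p : ℕ} (hp : p.Prime) (h2 : 2 < p) (l : ℕ) :
    IsUnit ((4 : ZMod (p ^ 2)) ^ l) := by
  have h := isUnit_natCast_of_lt hp 2 (by norm_num) h2
  have : (4 : ZMod (p ^ 2)) ^ l = (((2 : ℕ) : ZMod (p ^ 2)) ^ 2) ^ l := by norm_num
  rw [this]
  exact (h.pow 2).pow l

/-- The reduction modulo `p²` of an integer divided by `4 ^ l`. -/
theorem four_pow_mul_ratMod {p : ℕ} (hp : p.Prime) (h2 : 2 < p) (l : ℕ) (a : ℤ) (q : ℚ)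
    (hq : q = a / 4 ^ l) : 4 ^ l * ratMod (p ^ 2) q = a := by
  have h4 : IsUnit (((4 ^ l : ℤ)) : ZMod (p ^ 2)) := by
    simpa using isUnit_four_pow hp h2 l
  rw [(ModIntegral.of_eq_div a (4 ^ l) (by positivity) h4 (by rw [hq]; push_cast; rfl)).2]
  have := ZMod.mul_inv_of_unit _ h4
  push_cast at this ⊢
  linear_combination (a : ZMod (p ^ 2)) * this

theorem two_zpow_one_sub (l : ℕ) : (2 : ℚ) ^ (1 - 2 * (l : ℤ)) = 2 / 4 ^ l := by
  rw [zpow_sub₀ two_ne_zero, zpow_one, zpow_mul]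
  norm_num

end FMZV

theorem theorem1p3 (l m : ℕ) (hlm : (l, m) ≠ (0, 0)) :
    (∑ μ ∈ Finset.Nat.antidiagonalTuple (2 * l + 1) m, FMZV.zeta 2 (FMZV.insertTwos l μ)
      = ((-1 : ℚ) ^ m * ((-1 : ℚ) ^ l * (2 : ℚ) ^ (1 - 2 * (l : ℤ)) * ((l + m).choose l : ℚ)
          - 4 * ((2 * l + m).choose (2 * l) : ℚ))) •
        (FMZV.beta (4 * l + 2 * m + 1) * FMZV.bp)) ∧
    (∑ μ ∈ Finset.Nat.antidiagonalTuple (2 * l + 1) m, FMZV.zetaStar 2 (FMZV.insertTwos l μ)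
      = ((-1 : ℚ) ^ l * (2 : ℚ) ^ (1 - 2 * (l : ℤ)) * ((l + m).choose l : ℚ)) •
        (FMZV.beta (4 * l + 2 * m + 1) * FMZV.bp)) := by
  have h1 : 1 ≤ 2 * l + m := by
    by_contra h
    exact hlm (by rw [Prod.mk.injEq]; omega)
  have hk : 4 * l + 2 * m + 1 = 2 * (2 * l + m) + 1 := by ring
  constructor
  · simp only [FMZV.zeta, FMZV.beta, FMZV.bp]
    rw [← map_sum, ← map_mul, FMZV.A.smul_mk]
    -- With d = 2l+m the bound is p > 2d+1, as the formula for c_d requires; as d ≥ 1, it also makes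
    -- 4^l a unit.
    refine FMZV.A.mk_eq_of_lt 2 (4 * l + 2 * m + 1) _ _ fun p hp => ?_
    simp only [Finset.sum_apply, Pi.mul_apply, FMZV.ratMod_harmonicSum p.2,
      FMZV.insertTwos_eq_insertTwosFrom]
    change FMZV.insSum (FMZV.nestedSum (FMZV.invList p)) 0 (2 * l) m = _
    refine (FMZV.isUnit_four_pow p.2 (by omega) l).mul_left_cancel ?_
    rw [FMZV.insSum_nestedSum_eq p.2 h1 (by omega), FMZV.invSqCoeff_eq p.2 h1 (by omega), hk,
      ← mul_assoc (4 ^ l), FMZV.four_pow_mul_ratMod p.2 (by omega) l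
        ((-1) ^ m * ((-1) ^ l * 2 * ((l + m).choose l : ℤ)
          - 4 * 4 ^ l * ((2 * l + m).choose (2 * l) : ℤ))) _ ?_]
    · push_cast
      ring
    · rw [FMZV.two_zpow_one_sub]
      field_simp
      push_cast
      ring
  · simp only [FMZV.zetaStar, FMZV.beta, FMZV.bp]
    rw [← map_sum, ← map_mul, FMZV.A.smul_mk]
    refine FMZV.A.mk_eq_of_lt 2 (4 * l + 2 * m + 1) _ _ fun p hp => ?_
    simp only [Finset.sum_apply, Pi.mul_apply, FMZV.ratMod_harmonicSumStar p.2,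
      FMZV.insertTwos_eq_insertTwosFrom]
    change FMZV.insSum (FMZV.nestedSumStar (FMZV.invList p)) 0 (2 * l) m = _
    refine (FMZV.isUnit_four_pow p.2 (by omega) l).mul_left_cancel ?_
    rw [FMZV.insSum_nestedSumStar_eq p.2 h1 (by omega), FMZV.invSqCoeff_eq p.2 h1 (by omega), hk,
      ← mul_assoc (4 ^ l), FMZV.four_pow_mul_ratMod p.2 (by omega) l
        ((-1) ^ l * 2 * ((l + m).choose l : ℤ)) _ ?_]
    · push_cast
      ring
    · rw [FMZV.two_zpow_one_sub]
      push_cast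
      ring
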